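/- Let $(X_i,Y_i)_{i\ge1}$ be i.i.d. random vectors (inputs and output) with values in $\mathbb R^p\times\mathbb R$, let $x\in\mathbb R^p$, and assume $p_0=P(X_1\le x)>0$ (componentwise inequality). Put $F(y)=P(Y_1\le y\mid X_1\le x)$ and $q(\tau)=\inf\{y:F(y)\ge\tau\}$. Assume that $z_1=\sup\{z:F(z)<1\}$ is finite (so that $q(1)=z_1$, the production frontier at $x$) and that, for some $\xi_0<0$ and every $v>0$, $$\frac{1-F(z_1-vz)}{1-F(z_1-z)}\longrightarrow v^{-1/\xi_0}\qquad(z\downarrow0).$$ For $0<\tau<1$ let $\hat q_n(\tau)$ be any random variable that almost surely minimizes $q\mapsto\sum_{i=1}^n\rho_\tau(Y_i-q)\mathbf 1\{X_i\le x\}$ over $q\in\mathbb R$, where $\rho_\tau(u)=(\tau-\mathbf 1\{u\le0\})u$. Let $k_0>0$ and $m>1$ be such that $mk_0p_0>k_0p_0+1$, and let $k_1,\dots,k_L>0$; assume that none of $k_0p_0,\,mk_0p_0,\,k_1p_0,\dots,k_Lp_0$ is an integer. Put $\tau_{nl}=1-k_l/n$ and $$\hat\alpha_n=\frac{1}{\hat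 q_n(1-k_0/n)-\hat q_n(1-mk_0/n)}$$ ($n$ large; set to $0$ when the denominator vanishes). Let $\mathcal E_1,\mathcal E_2,\dots$ be i.i.d. standard exponential random variables, let $\eta(t)=t^{-\xi_0}$, and for $k>0$ with $kp_0\notin\mathbb Z$ let $$Z_\infty(k)=-\eta\Big(\sum_{i=1}^{h(k)}\mathcal E_i/p_0\Big),\qquad Z^c_\infty(k)=Z_\infty(k)+\eta(k),$$ where $h(k)$ is the unique integer in $[kp_0,kp_0+1]$ (the same sequence $(\mathcal E_i)$ is used for all $k$). Finally, let $\hat\omega_1,\hat\omega_2$ (depending on $n$) be random weights, defined on the probability space of the sample, with $\hat\omega_1+\hat\omega_2=1$ almost surely, $\hat\omega_1\to\omega_1$ and $\hat\omega_2\to\omega_2$ in probability, for constants $\omega_1,\omega_2\in\mathbb R$. Then, as $n\to\infty$: 1. Jointly in $l=1,\dots,L$, $$\big(\hat\alpha_n(\hat q_n(\tau_{nl})-q(1))\big)_{l=1}^{L}\ \xrightarrow{d}\ \Big(\frac{Z_\infty(k_l)}{Z_\infty(k_0)-Z_\infty(mk_0)}\Big)_{l=1}^{L}.$$ 2. For any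 two indices in $\{1,\dots,L\}$, written here as $1$ and $2$, $$\hat\alpha_n\big[\hat\omega_1\hat q_n(\tau_{n1})+\hat\omega_2\hat q_n(\tau_{n2})-(\omega_1q(\tau_{n1})+\omega_2q(\tau_{n2}))\big]\ \xrightarrow{d}\ \frac{\omega_1Z^c_\infty(k_1)+\omega_2Z^c_\infty(k_2)}{Z_\infty(k_0)-Z_\infty(mk_0)}.$$ 3. For the same two indices, $$\hat\alpha_n\big[\hat\omega_1\hat q_n(\tau_{n1})+\hat\omega_2\hat q_n(\tau_{n2})-q(1)\big]\ \xrightarrow{d}\ \frac{\omega_1Z^c_\infty(k_1)+\omega_2Z^c_\infty(k_2)-\omega_1\eta(k_1)-\omega_2\eta(k_2)}{Z_\infty(k_0)-Z_\infty(mk_0)}.$$ -/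

import Mathlib

open MeasureTheory ProbabilityTheory Filter Topology

namespace ExtremeQuantile

noncomputable section

/-- The non-standard conditional distribution function `F(y/x) = P(Y ≤ y | X ≤ x)`,
with `X ≤ x` understood componentwise. -/
def condDistFun {Ω : Type*} [MeasurableSpace Ω] {p : ℕ} (P : Measure Ω)
    (X : Ω → Fin p → ℝ) (Y : Ω → ℝ) (x : Fin p → ℝ) (y : ℝ) : ℝ :=
  (cond P {ω | X ω ≤ x}).real {ω | Y ω ≤ y}

/-- The quantile `q(τ) = inf {y : F(y) ≥ τ}`. The frontier is `q(1)`. -/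
def quantile (F : ℝ → ℝ) (τ : ℝ) : ℝ := sInf {y | τ ≤ F y}

/-- `F` belongs to the domain of attraction of type III generalized extreme value distributions
with index `ξ < 0`. Its right endpoint `z₁ = sup {z : F z < 1}` is finite. -/
structure InTypeThreeDomain (F : ℝ → ℝ) (ξ : ℝ) : Prop where
  index_neg : ξ < 0
  bddAbove : BddAbove {z | F z < 1}
  tail : ∀ v : ℝ, 0 < v →
    Tendsto (fun z : ℝ => (1 - F (sSup {z | F z < 1} - v * z)) / (1 - F (sSup {z | F z < 1} - z)))
      (𝓝[>] 0) (𝓝 (v ^ (-1 / ξ)))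

/-- The check function `ρ_τ(u) = (τ - 1{u ≤ 0}) u`. -/
def checkFun (τ u : ℝ) : ℝ := (τ - if u ≤ 0 then 1 else 0) * u

open Classical in
/-- The objective `q ↦ ∑ ρ_τ(Y_i - q) 1{X_i ≤ x}` over the first `n` observations,
evaluated at the sample point `ω`. -/
def objective {Ω : Type*} {p : ℕ} (X : ℕ → Ω → Fin p → ℝ) (Y : ℕ → Ω → ℝ) (x : Fin p → ℝ)
    (n : ℕ) (τ : ℝ) (ω : Ω) (q : ℝ) : ℝ :=
  ∑ i ∈ Finset.range n, checkFun τ (Y i ω - q) * (if X i ω ≤ x then 1 else 0)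

/-- `qhat n τ` is, for each sample size `n` and each level `0 < τ < 1`, a random variable that
is almost surely a minimizer of the objective (minimizers need not be unique; any choice is
allowed). Values at levels outside `(0, 1)` are irrelevant. -/
structure IsQuantileEstimator {Ω : Type*} [MeasurableSpace Ω] {p : ℕ} (P : Measure Ω)
    (X : ℕ → Ω → Fin p → ℝ) (Y : ℕ → Ω → ℝ) (x : Fin p → ℝ) (qhat : ℕ → ℝ → Ω → ℝ) : Prop where
  aemeasurable : ∀ n τ, AEMeasurable (qhat n τ) P
  isMinOn : ∀ n τ, 0 < τ → τ < 1 →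
    ∀ᵐ ω ∂P, IsMinOn (objective X Y x n τ ω) Set.univ (qhat n τ ω)

/-- The level `k` is admissible: `k > 0` and `k p₀` is not an integer. -/
def Admissible (p₀ k : ℝ) : Prop := 0 < k ∧ ∀ z : ℤ, k * p₀ ≠ z

/-- The extreme quantile level `τ_n = 1 - k / n`. -/
def level (k : ℝ) (n : ℕ) : ℝ := 1 - k / n

/-- The feasible rate `α̂_n = 1 / (q̂_n(1 - k₀/n) - q̂_n(1 - m k₀/n))`. -/
def feasibleRate {Ω : Type*} (qhat : ℕ → ℝ → Ω → ℝ) (k₀ m : ℝ) (n : ℕ) (ω : Ω) : ℝ :=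
  (qhat n (level k₀ n) ω - qhat n (level (m * k₀) n) ω)⁻¹

/-- `η(t) = t ^ (-ξ)`. -/
def eta (ξ t : ℝ) : ℝ := t ^ (-ξ)

/-- `h(k)`, the unique integer in `[k p₀, k p₀ + 1]`. -/
def hIndex (p₀ k : ℝ) : ℕ := ⌈k * p₀⌉₊

/-- For admissible `k`, `hIndex p₀ k` is the unique integer in `[k p₀, k p₀ + 1]`. -/
theorem hIndex_unique {p₀ k : ℝ} (hp : 0 < p₀) (hk : Admissible p₀ k) (j : ℤ) :
    (k * p₀ ≤ j ∧ j ≤ k * p₀ + 1) ↔ j = (hIndex p₀ k : ℤ) := by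
  have hpos : 0 < k * p₀ := mul_pos hk.1 hp
  have h1 : k * p₀ ≤ (hIndex p₀ k : ℝ) := Nat.le_ceil _
  have h2 : (hIndex p₀ k : ℝ) < k * p₀ + 1 := Nat.ceil_lt_add_one hpos.le
  constructor
  · rintro ⟨ha, hb⟩
    have hb' : (j : ℝ) < k * p₀ + 1 := by
      refine lt_of_le_of_ne hb fun h => hk.2 (j - 1) ?_
      push_cast
      linarith
    have e1 : (j : ℝ) < (((hIndex p₀ k : ℤ) + 1 : ℤ) : ℝ) := by push_cast; linarith
    have e2 : (((hIndex p₀ k : ℤ) : ℤ) : ℝ) < ((j + 1 : ℤ) : ℝ) := by push_cast; linarith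
    have e1' := Int.cast_lt.mp e1
    have e2' := Int.cast_lt.mp e2
    omega
  · rintro rfl
    push_cast
    exact ⟨h1, h2.le⟩

/-- `Z_∞(k) = -η(∑_{i ≤ h(k)} E_i / p₀)`; all levels `k` share the same sequence `E`. -/
def limitZ {Ω' : Type*} (E : ℕ → Ω' → ℝ) (p₀ ξ k : ℝ) (ω : Ω') : ℝ :=
  -eta ξ (∑ i ∈ Finset.range (hIndex p₀ k), E i ω / p₀)

/-- `Z^c_∞(k) = Z_∞(k) + η(k)`. -/
def limitZc {Ω' : Type*} (E : ℕ → Ω' → ℝ) (p₀ ξ k : ℝ) (ω : Ω') : ℝ :=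
  limitZ E p₀ ξ k ω + eta ξ k

end

end ExtremeQuantile

/-! Let `N` be the number of observations with `X ≤ x`. A minimizer `q` at level `1 - k/n` has at
most `k N / n` retained outputs above it and at least `k N / n` at or above it. Since `N / n → p₀`
almost surely and `k p₀` is not an integer, almost surely for all large `n` the estimator is exactly
the `h(k)`-th largest retained output. The theorem thus concerns finitely many extreme order
statistics.

The random number `N` is avoided by scoring each observation `exp Y` if retained and `0` otherwise:
the retained observations outrank the others and the sample size is `n`. A score has the law of a
decreasing function `g` of a uniform variable, with `g(s) = exp q(1 - s/p₀)` on `(0, p₀)`, so the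
top scores come from the smallest uniforms (`map_scores`, `integral_upperStats`). Multiplied by `n`,
the `d + 1` smallest uniforms have on increasing positive vectors `v` a density which tends, with an
integrable majorant, to `exp (-v_d)`. This is the density of the partial sums of standard
exponentials (`tendsto_integral_upperStats`, `integral_partialSums`).

What remains is a deterministic limit at fixed `v`. Inverting the tail condition gives `(q(1) - q(1
- s/n)) / (q(1) - q(1 - 1/n)) → s ^ (-ξ)` (`tendsto_gap_ratio`), and the unknown scale cancels
against the feasible rate. The normalized population quantiles are carried along as second
coordinates because the rate is random; the weights then enter by Slutsky's lemma. -/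

namespace ExtremeQuantile

/-! ### Distribution functions and their quantiles -/

/-- `F` is a distribution function on the real line. -/
structure IsDistFun (F : ℝ → ℝ) : Prop where
  mono : Monotone F
  rightCont : ∀ y, ContinuousWithinAt F (Set.Ici y) y
  atBot : Tendsto F atBot (𝓝 0)
  atTop : Tendsto F atTop (𝓝 1)

theorem isDistFun_cdf (μ : Measure ℝ) : IsDistFun (cdf μ) :=
  ⟨monotone_cdf μ, (cdf μ).right_continuous', tendsto_cdf_atBot μ, tendsto_cdf_atTop μ⟩

namespace IsDistFun

variable {F : ℝ → ℝ} (hF : IsDistFun F)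
include hF

theorem nonneg (y : ℝ) : 0 ≤ F y :=
  le_of_tendsto hF.atBot ((eventually_le_atBot y).mono fun _ h => hF.mono h)

theorem le_one (y : ℝ) : F y ≤ 1 :=
  ge_of_tendsto hF.atTop ((eventually_ge_atTop y).mono fun _ h => hF.mono h)

/-- The Galois connection between a distribution function and its quantile function. -/
theorem quantile_le_iff {τ : ℝ} (h0 : 0 < τ) (h1 : τ < 1) (y : ℝ) :
    quantile F τ ≤ y ↔ τ ≤ F y := by
  have hne : {y | τ ≤ F y}.Nonempty := (hF.atTop.eventually_const_le h1).exists
  have hbdd : BddBelow {y | τ ≤ F y} := by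
    obtain ⟨b, hb⟩ := (hF.atBot.eventually_lt_const h0).exists
    refine ⟨b, fun y hy => ?_⟩
    by_contra! hlt
    exact absurd (lt_of_le_of_lt (hF.mono hlt.le) hb) (not_lt.2 hy)
  refine ⟨fun h => ?_, fun h => csInf_le hbdd h⟩
  refine le_trans ?_ (hF.mono h)
  have ht : Tendsto F (𝓝[>] (quantile F τ)) (𝓝 (F (quantile F τ))) :=
    (hF.rightCont _).mono_left (nhdsWithin_mono _ Set.Ioi_subset_Ici_self)
  refine ge_of_tendsto ht ?_
  filter_upwards [self_mem_nhdsWithin] with z hz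
  obtain ⟨w, hw, hwz⟩ := exists_lt_of_csInf_lt hne hz
  exact le_trans hw (hF.mono hwz.le)

theorem quantile_mono {τ τ' : ℝ} (h0 : 0 < τ) (h1 : τ' < 1) (h : τ ≤ τ') :
    quantile F τ ≤ quantile F τ' :=
  (hF.quantile_le_iff h0 (h.trans_lt h1) _).2
    (h.trans ((hF.quantile_le_iff (h0.trans_le h) h1 _).1 le_rfl))

end IsDistFun

/-! ### Regular variation of the tail and of the quantile at the endpoint -/

theorem tendsto_const_mul_nhdsGT_zero {c : ℝ} (hc : 0 < c) :
    Tendsto (fun z : ℝ => c * z) (𝓝[>] 0) (𝓝[>] 0) := by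
  refine tendsto_nhdsWithin_iff.2 ⟨?_, ?_⟩
  · have := (continuous_const_mul c).tendsto 0
    rw [mul_zero] at this
    exact this.mono_left nhdsWithin_le_nhds
  · filter_upwards [self_mem_nhdsWithin] with z hz
    exact mul_pos hc (Set.mem_Ioi.1 hz)

/-- The right endpoint of a distribution function. -/
noncomputable def endpoint (F : ℝ → ℝ) : ℝ := sSup {z | F z < 1}

/-- The survival function at distance `z` below the right endpoint. -/
noncomputable def tail (F : ℝ → ℝ) (z : ℝ) : ℝ := 1 - F (endpoint F - z)

/-- The distance from the right endpoint to the quantile of level `1 - t`. -/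
noncomputable def gap (F : ℝ → ℝ) (t : ℝ) : ℝ := endpoint F - quantile F (1 - t)

section

variable {F : ℝ → ℝ} {ξ : ℝ} (hF : IsDistFun F) (hξ : InTypeThreeDomain F ξ)
include hF

theorem nonempty_lt_one : {z | F z < 1}.Nonempty :=
  (hF.atBot.eventually_lt_const one_pos).exists

include hξ

/-- Level `1` lies outside the Galois connection `quantile_le_iff`; finiteness of the endpoint makes
the set `{y | 1 ≤ F y}` nonempty. -/
theorem quantile_one : quantile F 1 = endpoint F := by
  obtain ⟨b, hb⟩ := hξ.bddAbove
  have hne' : {z | 1 ≤ F z}.Nonempty :=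
    ⟨b + 1, by
      by_contra h
      have h' : F (b + 1) < 1 := lt_of_not_ge h
      have := hb h'
      linarith⟩
  apply le_antisymm
  · refine le_of_forall_gt_imp_ge_of_dense fun a ha => ?_
    refine csInf_le ?_ (?_ : 1 ≤ F a)
    · obtain ⟨c, hc⟩ := nonempty_lt_one hF
      refine ⟨c, fun y hy => ?_⟩
      by_contra! h
      exact absurd ((hF.mono h.le).trans_lt hc) (not_lt.2 hy)
    · by_contra! h
      exact absurd (le_csSup hξ.bddAbove h) (not_le.2 ha)
  · refine le_csInf hne' fun y hy => csSup_le (nonempty_lt_one hF) fun z hz => ?_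
    by_contra! h
    exact absurd ((hF.mono h.le).trans_lt hz) (not_lt.2 hy)

omit hξ in
theorem tail_pos {z : ℝ} (hz : 0 < z) : 0 < tail F z := by
  obtain ⟨y, hy, hlt⟩ := exists_lt_of_lt_csSup (nonempty_lt_one hF)
    (show endpoint F - z < sSup {z | F z < 1} by unfold endpoint; linarith)
  have := hF.mono hlt.le
  have hy' : F y < 1 := hy
  unfold tail
  linarith

omit hξ in
theorem tail_mono : Monotone (tail F) := fun a b h => by
  have := hF.mono (show endpoint F - b ≤ endpoint F - a by linarith)
  unfold tail
  linarith

omit hF in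
theorem tendsto_tail_ratio {v : ℝ} (hv : 0 < v) :
    Tendsto (fun z => tail F (v * z) / tail F z) (𝓝[>] 0) (𝓝 (v ^ (-1 / ξ))) :=
  hξ.tail v hv

omit hF in
theorem neg_one_div_pos : 0 < -1 / ξ := div_pos_of_neg_of_neg (by norm_num) hξ.index_neg

/-- There is no atom at the endpoint: were the monotone limit nonzero, the ratio of tails at `2 z`
and `z` would tend to `1`, but it tends to `2 ^ (-1 / ξ) > 1`. -/
theorem tendsto_tail : Tendsto (tail F) (𝓝[>] 0) (𝓝 0) := by
  have hlim : Tendsto (tail F) (𝓝[>] 0) (𝓝 (sInf (tail F '' Set.Ioi 0))) :=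
    (tail_mono hF).tendsto_nhdsGT 0
  set c := sInf (tail F '' Set.Ioi 0) with hc
  have hscale := tendsto_const_mul_nhdsGT_zero (c := 2) two_pos
  by_cases h0 : c = 0
  · rwa [h0] at hlim
  · exfalso
    have h1 := (hlim.comp hscale).div hlim h0
    rw [div_self h0] at h1
    have h2 := tendsto_nhds_unique h1 (tendsto_tail_ratio hξ two_pos)
    exact absurd h2 (ne_of_lt (Real.one_lt_rpow one_lt_two (neg_one_div_pos hξ)))

omit hξ in
theorem tail_le_iff {t : ℝ} (h0 : 0 < t) (h1 : t < 1) (z : ℝ) :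
    tail F z ≤ t ↔ z ≤ gap F t := by
  have := hF.quantile_le_iff (τ := 1 - t) (by linarith) (by linarith) (endpoint F - z)
  unfold tail gap
  constructor
  · intro h
    have := this.2 (by linarith)
    linarith
  · intro h
    have := this.1 (by linarith)
    linarith

theorem gap_pos {t : ℝ} (h0 : 0 < t) (h1 : t < 1) : 0 < gap F t := by
  obtain ⟨z, hz, hz0⟩ := (((tendsto_tail hF hξ).eventually_lt_const h0).and
    self_mem_nhdsWithin).exists
  exact lt_of_lt_of_le hz0 ((tail_le_iff hF h0 h1 z).1 hz.le)

theorem tendsto_gap : Tendsto (gap F) (𝓝[>] 0) (𝓝[>] 0) := by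
  have hlt : ∀ᶠ t : ℝ in 𝓝[>] 0, 0 < t ∧ t < 1 := by
    filter_upwards [Ioo_mem_nhdsGT (zero_lt_one (α := ℝ))] with t ht using ht
  refine tendsto_nhdsWithin_iff.2 ⟨tendsto_order.2 ⟨fun a ha => ?_, fun a ha => ?_⟩, ?_⟩
  · filter_upwards [hlt] with t ht using ha.trans (gap_pos hF hξ ht.1 ht.2)
  · filter_upwards [hlt, Ioo_mem_nhdsGT (tail_pos hF ha)] with t ht ht'
    by_contra! h
    exact absurd ((tail_le_iff hF ht.1 ht.2 a).2 h) (not_le.2 ht'.2)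
  · filter_upwards [hlt] with t ht using gap_pos hF hξ ht.1 ht.2

/-- Regular variation of the quantile function at the right endpoint. -/
theorem tendsto_gap_ratio {s : ℝ} (hs : 0 < s) :
    Tendsto (fun t => gap F (s * t) / gap F t) (𝓝[>] 0) (𝓝 (s ^ (-ξ))) := by
  have hξ0 := hξ.index_neg
  have ha := neg_one_div_pos hξ
  have hsmall : ∀ᶠ t : ℝ in 𝓝[>] 0, 0 < t ∧ t < 1 ∧ 0 < s * t ∧ s * t < 1 := by
    filter_upwards [Ioo_mem_nhdsGT (zero_lt_one (α := ℝ)),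
      Ioo_mem_nhdsGT (one_div_pos.2 hs)] with t ht ht'
    refine ⟨ht.1, ht.2, mul_pos hs ht.1, ?_⟩
    have := mul_lt_mul_of_pos_left ht'.2 hs
    rwa [mul_one_div, div_self hs.ne'] at this
  have hpow : ∀ v : ℝ, 0 < v → (v ^ (-1 / ξ)) ^ (-ξ) = v := fun v hv => by
    rw [← Real.rpow_mul hv.le]
    have : -1 / ξ * -ξ = 1 := by rw [div_mul_eq_mul_div, neg_one_mul, neg_neg, div_self hξ0.ne]
    rw [this, Real.rpow_one]
  have hlow : ∀ v : ℝ, 0 < v → v < s ^ (-ξ) → v ^ (-1 / ξ) < s := fun v hv h => by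
    by_contra! hle
    have := Real.rpow_le_rpow hs.le hle (show 0 ≤ -ξ by linarith)
    rw [hpow v hv] at this
    linarith
  have hup : ∀ v : ℝ, 0 < v → s ^ (-ξ) < v → s < v ^ (-1 / ξ) := fun v hv h => by
    by_contra! hle
    have := Real.rpow_le_rpow (Real.rpow_nonneg hv.le _) hle (show 0 ≤ -ξ by linarith)
    rw [hpow v hv] at this
    linarith
  have hspos : 0 < s ^ (-ξ) := Real.rpow_pos_of_pos hs _
  refine tendsto_order.2 ⟨fun b hb => ?_, fun b hb => ?_⟩
  -- Lower bound: for `v < s ^ (-ξ)` the tail at `v * gap F t` is eventually below `s * tail F (gap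
  -- F t) ≤ s * t`, hence `v * gap F t ≤ gap F (s * t)`.
  · obtain ⟨v, hv1, hv2⟩ := exists_between (max_lt hb hspos)
    have hv0 : 0 < v := (le_max_right _ _).trans_lt hv1
    have hr := ((tendsto_tail_ratio hξ hv0).comp (tendsto_gap hF hξ)).eventually_lt_const
      (hlow v hv0 hv2)
    filter_upwards [hr, hsmall] with t hr ⟨h1, h2, h3, h4⟩
    have hd := gap_pos hF hξ h1 h2
    have hU := tail_pos hF hd
    have hle : tail F (gap F t) ≤ t := (tail_le_iff hF h1 h2 _).2 le_rfl
    have h5 : tail F (v * gap F t) < s * tail F (gap F t) := (div_lt_iff₀ hU).1 hr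
    have h6 : tail F (v * gap F t) ≤ s * t :=
      h5.le.trans (mul_le_mul_of_nonneg_left hle hs.le)
    have h7 := (tail_le_iff hF h3 h4 _).1 h6
    exact ((le_max_left _ _).trans_lt hv1).trans_le ((le_div_iff₀ hd).2 h7)
  · obtain ⟨v, hv1, hv2⟩ := exists_between hb
    -- The tail may jump at `gap F t`, where only `tail ≤ t` is known. Enlarging the point by the
    -- factor `v / w > 1` makes the tail exceed `t`, and `w` still lies above `s ^ (-ξ)`.
    obtain ⟨w, hw1, hw2⟩ := exists_between hv1
    have hw0 : 0 < w := hspos.trans hw1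
    have hv0 : 0 < v := hw0.trans hw2
    have hl : 1 < v / w := (one_lt_div hw0).2 hw2
    have hl0 : 0 < v / w := one_pos.trans hl
    have hscale := tendsto_const_mul_nhdsGT_zero hl0
    have hr := ((tendsto_tail_ratio hξ hw0).comp
      (hscale.comp (tendsto_gap hF hξ))).eventually_const_lt (hup w hw0 hw1)
    filter_upwards [hr, hsmall] with t hr ⟨h1, h2, h3, h4⟩
    have hd := gap_pos hF hξ h1 h2
    have hU := tail_pos hF (mul_pos hl0 hd)
    have h5 : s * tail F (v / w * gap F t) < tail F (w * (v / w * gap F t)) :=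
      (lt_div_iff₀ hU).1 hr
    have h6 : t < tail F (v / w * gap F t) := by
      by_contra! h
      have := (tail_le_iff hF h1 h2 _).1 h
      nlinarith
    have h7 : w * (v / w * gap F t) = v * gap F t := by field_simp
    rw [h7] at h5
    have h8 : gap F (s * t) < v * gap F t := by
      by_contra! h
      have := (tail_le_iff hF h3 h4 _).2 h
      have := mul_lt_mul_of_pos_left h6 hs
      linarith
    exact ((div_lt_iff₀ hd).2 h8).trans hv2

theorem tendsto_gap_div_nat {s : ℝ} (hs : 0 < s) :
    Tendsto (fun n : ℕ => gap F (s / n) / gap F (1 / n)) atTop (𝓝 (s ^ (-ξ))) := by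
  have h : Tendsto (fun n : ℕ => 1 / (n : ℝ)) atTop (𝓝[>] 0) := by
    refine tendsto_nhdsWithin_iff.2 ⟨tendsto_one_div_atTop_nhds_zero_nat, ?_⟩
    filter_upwards [eventually_gt_atTop 0] with n hn
    have : (0 : ℝ) < n := Nat.cast_pos.2 hn
    exact one_div_pos.2 this
  refine ((tendsto_gap_ratio hF hξ hs).comp h).congr fun n => ?_
  simp [div_eq_mul_inv]

end

/-! ### Upper order statistics through counts -/

/-- The number of coordinates of `y` with values in a given set. -/
noncomputable def countIn {n : ℕ} (y : Fin n → ℝ) (s : Set ℝ) : ℕ := by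
  classical exact (Finset.univ.filter fun i => y i ∈ s).card

theorem countIn_mono {n : ℕ} (y : Fin n → ℝ) {s t : Set ℝ} (h : s ⊆ t) :
    countIn y s ≤ countIn y t := by
  classical
  exact Finset.card_le_card (Finset.monotone_filter_right _ fun i _ hi => h hi)

theorem countIn_le {n : ℕ} (y : Fin n → ℝ) (s : Set ℝ) : countIn y s ≤ n := by
  classical
  exact (Finset.card_filter_le _ _).trans (by simp)

theorem countIn_eq_of_forall_mem {n : ℕ} {y : Fin n → ℝ} {s : Set ℝ} (h : ∀ i, y i ∈ s) :
    countIn y s = n := by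
  classical
  rw [countIn, Finset.filter_true_of_mem fun j _ => h j]
  simp

theorem exists_mem_of_countIn_pos {n : ℕ} {y : Fin n → ℝ} {s : Set ℝ} (h : 0 < countIn y s) :
    ∃ i, y i ∈ s := by
  classical
  obtain ⟨i, hi⟩ := Finset.card_pos.1 h
  exact ⟨i, (Finset.mem_filter.1 hi).2⟩

theorem measurable_countIn {n : ℕ} {s : Set ℝ} (hs : MeasurableSet s) :
    Measurable fun y : Fin n → ℝ => countIn y s := by
  classical
  unfold countIn
  simp only [Finset.card_filter]
  refine Finset.measurable_sum _ fun i _ => Measurable.ite ?_ measurable_const measurable_const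
  exact measurable_pi_apply i hs

/-- The `h`-th largest coordinate of `y`, for `1 ≤ h ≤ n`. -/
noncomputable def upperStat {n : ℕ} (h : ℕ) (y : Fin n → ℝ) : ℝ :=
  sSup {t | h ≤ countIn y (Set.Ici t)}

theorem upperStat_eq {n h : ℕ} {y : Fin n → ℝ} {t : ℝ} (h1 : h ≤ countIn y (Set.Ici t))
    (h2 : countIn y (Set.Ioi t) < h) : upperStat h y = t := by
  have hb : ∀ s ∈ {t | h ≤ countIn y (Set.Ici t)}, s ≤ t := fun s hs => by
    by_contra! hlt
    have := countIn_mono y (Set.Ici_subset_Ioi.2 hlt)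
    have hs' : h ≤ countIn y (Set.Ici s) := hs
    omega
  exact le_antisymm (csSup_le ⟨t, h1⟩ hb) (le_csSup ⟨t, hb⟩ h1)

/-- Take the largest coordinate with at least `h` coordinates at or above it. If `h` coordinates
were strictly above, the smallest of these would qualify too. -/
theorem exists_countIn {n h : ℕ} (y : Fin n → ℝ) (h1 : 1 ≤ h) (h2 : h ≤ n) :
    ∃ t, h ≤ countIn y (Set.Ici t) ∧ countIn y (Set.Ioi t) < h := by
  classical
  set A := Finset.univ.filter fun i => h ≤ countIn y (Set.Ici (y i)) with hA
  have hn : (Finset.univ : Finset (Fin n)).Nonempty := ⟨⟨0, by omega⟩, Finset.mem_univ _⟩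
  have hne : A.Nonempty := by
    obtain ⟨i, -, hi⟩ := Finset.exists_min_image _ y hn
    refine ⟨i, Finset.mem_filter.2 ⟨Finset.mem_univ _, ?_⟩⟩
    rw [countIn_eq_of_forall_mem (s := Set.Ici (y i)) fun j => hi j (Finset.mem_univ j)]
    exact h2
  obtain ⟨i, hi, hmax⟩ := Finset.exists_max_image _ y hne
  refine ⟨y i, (Finset.mem_filter.1 hi).2, ?_⟩
  by_contra! hle
  have hB : (Finset.univ.filter fun j => y j ∈ Set.Ioi (y i)).Nonempty := by
    obtain ⟨j, hj⟩ := exists_mem_of_countIn_pos (h1.trans hle)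
    exact ⟨j, Finset.mem_filter.2 ⟨Finset.mem_univ _, hj⟩⟩
  obtain ⟨j, hj, hmin⟩ := Finset.exists_min_image _ y hB
  have hij : y i < y j := (Finset.mem_filter.1 hj).2
  have hjA : j ∈ A := by
    refine Finset.mem_filter.2 ⟨Finset.mem_univ _, hle.trans ?_⟩
    refine Finset.card_le_card fun l hl => ?_
    exact Finset.mem_filter.2 ⟨Finset.mem_univ _, hmin l hl⟩
  exact absurd (hmax j hjA) (not_le.2 hij)

theorem le_upperStat_iff {n h : ℕ} (y : Fin n → ℝ) (h1 : 1 ≤ h) (h2 : h ≤ n) (t : ℝ) :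
    t ≤ upperStat h y ↔ h ≤ countIn y (Set.Ici t) := by
  obtain ⟨s, hs1, hs2⟩ := exists_countIn y h1 h2
  rw [upperStat_eq hs1 hs2]
  refine ⟨fun h => hs1.trans (countIn_mono y (Set.Ici_subset_Ici.2 h)), fun h => ?_⟩
  by_contra! hlt
  have := countIn_mono y (Set.Ici_subset_Ioi.2 hlt)
  omega

theorem measurable_upperStat (n h : ℕ) : Measurable fun y : Fin n → ℝ => upperStat h y := by
  classical
  by_cases hh : 1 ≤ h ∧ h ≤ n
  · refine measurable_of_Ici fun t => ?_
    have : (fun y : Fin n → ℝ => upperStat h y) ⁻¹' Set.Ici t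
        = (fun y => countIn y (Set.Ici t)) ⁻¹' Set.Ici h := by
      ext y
      exact le_upperStat_iff y hh.1 hh.2 t
    rw [this]
    exact measurable_countIn measurableSet_Ici measurableSet_Ici
  -- Out of range, the defining set is the whole line or empty, and `sSup` takes its default value
  -- `0`.
  · have : ∀ y : Fin n → ℝ, upperStat h y = 0 := fun y => by
      unfold upperStat
      by_cases h0 : h = 0
      · simp [h0]
      · have : {t | h ≤ countIn y (Set.Ici t)} = ∅ := by
          refine Set.eq_empty_of_forall_notMem fun t ht => ?_
          have h3 := countIn_le y (Set.Ici t)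
          have h4 : h ≤ countIn y (Set.Ici t) := ht
          omega
        rw [this, Real.sSup_empty]
    simp only [this]
    exact measurable_const

/-- The vector of the `d + 1` largest coordinates, in decreasing order. -/
noncomputable def upperStats {n : ℕ} (d : ℕ) (y : Fin n → ℝ) (j : Fin (d + 1)) : ℝ :=
  upperStat (j + 1) y

theorem measurable_upperStats (n d : ℕ) : Measurable (upperStats d : (Fin n → ℝ) → _) :=
  measurable_pi_lambda _ fun _ => measurable_upperStat n _

/-! ### Symmetrization over the positions of the smallest coordinates -/

/-- The set of points whose `d + 1` smallest coordinates are, in increasing order, those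
selected by `σ`. -/
def lowestAt {n d : ℕ} (σ : Fin (d + 1) ↪ Fin n) : Set (Fin n → ℝ) :=
  {S | StrictMono (S ∘ σ) ∧ ∀ i, i ∉ Set.range σ → S (σ (Fin.last d)) < S i}

/-- A decreasing `g` turns smallest arguments into largest values. Ties created by `g` do no harm: a
strict inequality between values still forces one between arguments, so the two counts identify the
order statistic. -/
theorem upperStats_comp_of_mem_lowestAt {n d : ℕ} {σ : Fin (d + 1) ↪ Fin n} {S : Fin n → ℝ}
    (hS : S ∈ lowestAt σ) {g : ℝ → ℝ} {I : Set ℝ} (hg : AntitoneOn g I) (hI : ∀ i, S i ∈ I) :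
    upperStats d (g ∘ S) = g ∘ S ∘ σ := by
  classical
  obtain ⟨hmono, hrest⟩ := hS
  funext j
  refine upperStat_eq ?_ ?_
  · have : ((Finset.Iic j).map σ).card ≤ countIn (g ∘ S) (Set.Ici (g (S (σ j)))) := by
      refine Finset.card_le_card fun i hi => ?_
      obtain ⟨l, hl, rfl⟩ := Finset.mem_map.1 hi
      exact Finset.mem_filter.2 ⟨Finset.mem_univ _,
        hg (hI _) (hI _) (hmono.monotone (Finset.mem_Iic.1 hl))⟩
    simpa using this
  · have : countIn (g ∘ S) (Set.Ioi (g (S (σ j)))) ≤ ((Finset.Iio j).map σ).card := by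
      refine Finset.card_le_card fun i hi => ?_
      have hi' : g (S (σ j)) < g (S i) := (Finset.mem_filter.1 hi).2
      have hlt : S i < S (σ j) := by
        by_contra! hle
        exact absurd (hg (hI _) (hI _) hle) (not_le.2 hi')
      have hmem : i ∈ Set.range σ := by
        by_contra hn
        have h1 := hrest i hn
        have h2 : S (σ j) ≤ S (σ (Fin.last d)) := hmono.monotone (Fin.le_last j)
        linarith
      obtain ⟨l, rfl⟩ := hmem
      exact Finset.mem_map.2 ⟨l, Finset.mem_Iio.2 (hmono.lt_iff_lt.1 hlt), rfl⟩
    simp only [Finset.card_map, Fin.card_Iio] at this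
    simpa using Nat.lt_succ_of_le this

theorem existsUnique_mem_lowestAt {n d : ℕ} (hn : d + 1 ≤ n) {S : Fin n → ℝ}
    (hS : Function.Injective S) : ∃! σ : Fin (d + 1) ↪ Fin n, S ∈ lowestAt σ := by
  have hmono : StrictMono (S ∘ Tuple.sort S) :=
    (Tuple.monotone_sort S).strictMono_of_injective (hS.comp (Tuple.sort S).injective)
  set σ := (Fin.castLEEmb hn).trans (Tuple.sort S).toEmbedding
  have hσ : S ∈ lowestAt σ := by
    refine ⟨fun a b hab => hmono (by simpa using hab), fun i hi => ?_⟩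
    obtain ⟨k, rfl⟩ := (Tuple.sort S).surjective i
    refine hmono ?_
    by_contra! hle
    have : (k : ℕ) ≤ d := hle
    exact hi ⟨⟨k, by omega⟩, rfl⟩
  refine ⟨σ, hσ, fun τ hτ => ?_⟩
  -- Uniqueness: the upper statistics of `-S` determine `S ∘ τ`, and `S` is injective.
  have hneg : AntitoneOn (fun x : ℝ => -x) Set.univ := fun a _ b _ h => neg_le_neg h
  have e := (upperStats_comp_of_mem_lowestAt hτ hneg fun _ => Set.mem_univ _).symm.trans
    (upperStats_comp_of_mem_lowestAt hσ hneg fun _ => Set.mem_univ _)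
  ext j : 1
  exact hS (neg_injective (congrFun e j))

theorem measurableSet_strictMono (d : ℕ) : MeasurableSet {u : Fin d → ℝ | StrictMono u} := by
  have : {u : Fin d → ℝ | StrictMono u} = ⋂ i, ⋂ j, {u | i < j → u i < u j} := by
    ext u
    simp [StrictMono]
  rw [this]
  refine MeasurableSet.iInter fun i => MeasurableSet.iInter fun j => ?_
  by_cases h : i < j
  · simpa [h] using measurableSet_lt (measurable_pi_apply i) (measurable_pi_apply j)
  · simp [h]

theorem measurableSet_lowestAt {n d : ℕ} (σ : Fin (d + 1) ↪ Fin n) :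
    MeasurableSet (lowestAt σ) := by
  have hσ : Measurable fun S : Fin n → ℝ => S ∘ σ :=
    measurable_pi_lambda _ fun j => measurable_pi_apply (σ j)
  have h1 : MeasurableSet {S : Fin n → ℝ | StrictMono (S ∘ σ)} :=
    hσ (measurableSet_strictMono (d + 1))
  have h2 : MeasurableSet {S : Fin n → ℝ | ∀ i, i ∉ Set.range σ → S (σ (Fin.last d)) < S i} := by
    simp only [Set.ofPred_forall]
    exact MeasurableSet.iInter fun i => MeasurableSet.iInter fun _ =>
      measurableSet_lt (measurable_pi_apply _) (measurable_pi_apply i)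
  exact h1.inter h2

/-- The coordinates selected by an embedding, followed by the others. -/
noncomputable def splitEquiv {n d : ℕ} (σ : Fin (d + 1) ↪ Fin n) :
    Fin (d + 1) ⊕ ↥(Set.range σ)ᶜ ≃ Fin n := by
  classical
  exact (Equiv.sumCongr (Equiv.ofInjective σ σ.injective) (Equiv.refl _)).trans
    (Equiv.Set.sumCompl (Set.range σ))

theorem card_compl_range {n d : ℕ} (σ : Fin (d + 1) ↪ Fin n) :
    Fintype.card ↥(Set.range σ)ᶜ = n - (d + 1) := by
  have := Fintype.card_congr (splitEquiv σ)
  simp only [Fintype.card_sum, Fintype.card_fin] at this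
  omega

/-- Fubini over selected and remaining coordinates: each remaining one only has to exceed the last
selected one, which gives the power. The value does not depend on `σ`, so all embeddings contribute
equally. -/
theorem integral_indicator_lowestAt (ν : Measure ℝ) [IsProbabilityMeasure ν] {n d : ℕ}
    (σ : Fin (d + 1) ↪ Fin n) {ψ : (Fin (d + 1) → ℝ) → ℝ} (hψ : Measurable ψ) {B : ℝ}
    (hB : ∀ u, |ψ u| ≤ B) :
    ∫ S, (lowestAt σ).indicator (fun S => ψ (S ∘ σ)) S ∂(Measure.pi fun _ : Fin n => ν)
      = ∫ u, {u : Fin (d + 1) → ℝ | StrictMono u}.indicator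
          (fun u => ψ u * ν.real (Set.Ioi (u (Fin.last d))) ^ (n - (d + 1))) u
          ∂(Measure.pi fun _ : Fin (d + 1) => ν) := by
  classical
  have hmp1 := measurePreserving_sumPiEquivProdPi_symm
    (fun _ : Fin (d + 1) ⊕ ↥(Set.range σ)ᶜ => ν)
  have hmp2 := measurePreserving_piCongrLeft (fun _ : Fin n => ν) (splitEquiv σ)
  have hψσ : Measurable fun S : Fin n → ℝ => ψ (S ∘ σ) :=
    hψ.comp (measurable_pi_lambda _ fun j => measurable_pi_apply (σ j))
  have hm := hψσ.indicator (measurableSet_lowestAt σ)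
  have hmp := hmp2.comp hmp1
  have hval : ∀ (w : (Fin (d + 1) → ℝ) × (↥(Set.range σ)ᶜ → ℝ)) (s),
      (MeasurableEquiv.piCongrLeft (fun _ => ℝ) (splitEquiv σ) ∘
        (MeasurableEquiv.sumPiEquivProdPi fun _ => ℝ).symm) w (splitEquiv σ s)
        = Sum.elim w.1 w.2 s := by
    intro w s
    simp only [Function.comp, MeasurableEquiv.coe_piCongrLeft]
    rw [Equiv.piCongrLeft_apply_apply]
    rcases s with s | s <;> rfl
  rw [← hmp.map_eq, integral_map hmp.measurable.aemeasurable hm.aestronglyMeasurable]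
  set T := (MeasurableEquiv.piCongrLeft (fun _ : Fin n => ℝ) (splitEquiv σ) ∘
        (MeasurableEquiv.sumPiEquivProdPi fun _ => ℝ).symm) with hT
  have hl : ∀ w j, T w (σ j) = w.1 j := fun w j => hval w (Sum.inl j)
  have hr : ∀ w (i : ↥(Set.range σ)ᶜ), T w i = w.2 i := fun w i => hval w (Sum.inr i)
  have hcomp : ∀ w, T w ∘ σ = w.1 := fun w => funext (hl w)
  have hint : Integrable (fun w => (lowestAt σ).indicator (fun S => ψ (S ∘ σ)) (T w))
      ((Measure.pi fun _ : Fin (d + 1) => ν).prod (Measure.pi fun _ : ↥(Set.range σ)ᶜ => ν)) := by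
    refine Integrable.of_bound (hm.comp hmp.measurable).aestronglyMeasurable B ?_
    refine Eventually.of_forall fun w => ?_
    refine (norm_indicator_le_norm_self _ _).trans (hB _)
  rw [integral_prod _ hint]
  refine integral_congr_ae (Eventually.of_forall fun u => ?_)
  have hset : ∀ r, (lowestAt σ).indicator (fun S => ψ (S ∘ σ)) (T (u, r))
      = (Set.univ.pi fun _ : ↥(Set.range σ)ᶜ => Set.Ioi (u (Fin.last d))).indicator
        (fun _ => {u : Fin (d + 1) → ℝ | StrictMono u}.indicator ψ u) r := by
    intro r
    by_cases h1 : StrictMono u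
    · by_cases h2 : r ∈ Set.univ.pi fun _ : ↥(Set.range σ)ᶜ => Set.Ioi (u (Fin.last d))
      · have h3 : T (u, r) ∈ lowestAt σ := by
          refine ⟨by rw [hcomp]; exact h1, fun i hi => ?_⟩
          rw [hl, hr (u, r) ⟨i, hi⟩]
          exact h2 ⟨i, hi⟩ trivial
        rw [Set.indicator_of_mem h3, Set.indicator_of_mem h2,
          Set.indicator_of_mem (Set.mem_ofPred.2 h1), hcomp]
      · have h3 : T (u, r) ∉ lowestAt σ := fun h => h2 fun i _ => by
          have := h.2 i i.2
          rwa [hl, hr] at this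
        rw [Set.indicator_of_notMem h3, Set.indicator_of_notMem h2]
    · have h3 : T (u, r) ∉ lowestAt σ := fun h => h1 (by have := h.1; rwa [hcomp] at this)
      have h4 : u ∉ {u : Fin (d + 1) → ℝ | StrictMono u} := h1
      rw [Set.indicator_of_notMem h3]
      simp [Set.indicator_of_notMem h4]
  simp only [hset]
  rw [integral_indicator_const _ (MeasurableSet.univ_pi fun _ => measurableSet_Ioi),
    measureReal_def, Measure.pi_pi]
  by_cases h1 : u ∈ {u : Fin (d + 1) → ℝ | StrictMono u}
  · rw [Set.indicator_of_mem h1, Set.indicator_of_mem h1, Finset.prod_const, Finset.card_univ,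
      card_compl_range, ENNReal.toReal_pow, smul_eq_mul, mul_comm, measureReal_def]
  · simp only [Set.indicator_of_notMem h1, smul_zero]

theorem ae_injective_volume (n : ℕ) : ∀ᵐ S : Fin n → ℝ, Function.Injective S := by
  have h : ∀ i j : Fin n, i ≠ j → ∀ᵐ S : Fin n → ℝ, S i ≠ S j := by
    intro i j hij
    set W : Submodule ℝ (Fin n → ℝ) :=
      LinearMap.ker ((LinearMap.proj i : (Fin n → ℝ) →ₗ[ℝ] ℝ) - LinearMap.proj j) with hW
    have hne : W ≠ ⊤ := by
      intro h
      have : Pi.single i (1 : ℝ) ∈ W := h ▸ Submodule.mem_top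
      simp [hW, LinearMap.mem_ker, hij.symm] at this
    have h0 := Measure.addHaar_submodule (volume : Measure (Fin n → ℝ)) W hne
    refine measure_mono_null (fun S hS => ?_) h0
    have hS' : S i = S j := by simpa using hS
    simp [hW, LinearMap.mem_ker, hS']
  have h' : ∀ᵐ S : Fin n → ℝ, ∀ i j : Fin n, i ≠ j → S i ≠ S j := by
    simp only [ae_all_iff]
    exact fun i j hij => h i j hij
  filter_upwards [h'] with S hS i j hij
  by_contra hne
  exact hS i j hne hij

/-! ### Largest values of a decreasing function of uniforms -/

/-- The uniform distribution on `(0, 1)`. -/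
noncomputable def unif : Measure ℝ := volume.restrict (Set.Ioo 0 1)

instance : IsProbabilityMeasure unif := ⟨by simp [unif]⟩

theorem pi_unif (n : ℕ) : (Measure.pi fun _ : Fin n => unif)
    = volume.restrict (Set.univ.pi fun _ : Fin n => Set.Ioo (0 : ℝ) 1) := by
  rw [volume_pi, Measure.restrict_pi_pi]
  rfl

theorem unif_real_Ioi {t : ℝ} (h0 : 0 < t) (h1 : t < 1) : unif.real (Set.Ioi t) = 1 - t := by
  have : Set.Ioi t ∩ Set.Ioo 0 1 = Set.Ioo t 1 := by
    ext s
    simp only [Set.mem_inter_iff, Set.mem_Ioi, Set.mem_Ioo]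
    constructor
    · rintro ⟨a, b, c⟩; exact ⟨a, c⟩
    · rintro ⟨a, c⟩; exact ⟨a, h0.trans a, c⟩
  rw [unif, measureReal_restrict_apply measurableSet_Ioi, this, Real.volume_real_Ioo_of_le h1.le]

/-- The joint law of the largest values of `g` at independent uniform variables. -/
theorem integral_upperStats {n d : ℕ} (hn : d + 1 ≤ n) {g : ℝ → ℝ} (hgm : Measurable g)
    (hg : AntitoneOn g (Set.Ioo 0 1)) {Φ : (Fin (d + 1) → ℝ) → ℝ} (hΦ : Measurable Φ) {B : ℝ}
    (hB : ∀ u, |Φ u| ≤ B) :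
    ∫ S, Φ (upperStats d (g ∘ S)) ∂(Measure.pi fun _ : Fin n => unif)
      = n.descFactorial (d + 1) * ∫ u, {u : Fin (d + 1) → ℝ | StrictMono u}.indicator
          (fun u => Φ (g ∘ u) * unif.real (Set.Ioi (u (Fin.last d))) ^ (n - (d + 1))) u
          ∂(Measure.pi fun _ : Fin (d + 1) => unif) := by
  classical
  have hgc : ∀ k : ℕ, Measurable fun u : Fin k → ℝ => g ∘ u := fun k =>
    measurable_pi_lambda _ fun j => hgm.comp (measurable_pi_apply j)
  -- Almost surely there are no ties, so exactly one of the indicators is active.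
  have hae : ∀ᵐ S ∂(Measure.pi fun _ : Fin n => unif), Φ (upperStats d (g ∘ S))
      = ∑ σ : Fin (d + 1) ↪ Fin n, (lowestAt σ).indicator (fun S => Φ (g ∘ (S ∘ σ))) S := by
    rw [pi_unif]
    filter_upwards [ae_restrict_of_ae (ae_injective_volume n),
      ae_restrict_mem (MeasurableSet.univ_pi fun _ => measurableSet_Ioo)] with S hS hS'
    obtain ⟨σ, hσ, huniq⟩ := existsUnique_mem_lowestAt hn hS
    rw [Finset.sum_eq_single σ, Set.indicator_of_mem hσ,
      upperStats_comp_of_mem_lowestAt hσ hg fun i => hS' i trivial]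
    · intro τ _ hτ
      exact Set.indicator_of_notMem (fun h => hτ (huniq τ h)) _
    · exact fun h => absurd (Finset.mem_univ _) h
  have hψ : Measurable fun u : Fin (d + 1) → ℝ => Φ (g ∘ u) := hΦ.comp (hgc _)
  rw [integral_congr_ae hae, integral_finsetSum]
  · simp only [integral_indicator_lowestAt unif _ hψ fun u => hB _]
    rw [Finset.sum_const, Finset.card_univ, Fintype.card_embedding_eq, Fintype.card_fin,
      Fintype.card_fin, nsmul_eq_mul]
  · intro σ _
    refine Integrable.of_bound (((hψ.comp (measurable_pi_lambda _ fun j =>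
      measurable_pi_apply (σ j))).indicator (measurableSet_lowestAt σ)).aestronglyMeasurable) B ?_
    exact Eventually.of_forall fun S => (norm_indicator_le_norm_self _ _).trans (hB _)

/-! ### Scaling by the sample size and dominated convergence -/

/-- The set of increasing vectors with positive coordinates. -/
def chamber (d : ℕ) : Set (Fin (d + 1) → ℝ) := {v | StrictMono v ∧ 0 < v 0}

theorem measurableSet_chamber (d : ℕ) : MeasurableSet (chamber d) :=
  (measurableSet_strictMono (d + 1)).inter
    (measurableSet_lt measurable_const (measurable_pi_apply 0))

theorem pos_of_mem_chamber {d : ℕ} {v : Fin (d + 1) → ℝ} (hv : v ∈ chamber d) (j : Fin (d + 1)) :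
    0 < v j := hv.2.trans_le (hv.1.monotone (Fin.zero_le j))

theorem smul_mem_chamber_iff {d : ℕ} {c : ℝ} (hc : 0 < c) (v : Fin (d + 1) → ℝ) :
    c • v ∈ chamber d ↔ v ∈ chamber d := by
  have h : StrictMono (c • v) ↔ StrictMono v :=
    forall₂_congr fun a b => by simp [mul_lt_mul_iff_right₀ hc]
  simp [chamber, h, hc]

/-- The density of the scaled smallest `d + 1` of `n` independent uniform variables, up to
normalization. -/
noncomputable def binomialWeight (n d : ℕ) (t : ℝ) : ℝ :=
  if t < n then (1 - t / n) ^ (n - (d + 1)) else 0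

/-- The substitution `v = n u` has Jacobian `n ^ (-(d + 1))`, which turns the combinatorial factor
into one tending to `1` and `(1 - u_d)` into `(1 - v_d / n)`. -/
theorem integral_upperStats_scaled {n d : ℕ} (hn : d + 1 ≤ n) {g : ℝ → ℝ} (hgm : Measurable g)
    (hg : AntitoneOn g (Set.Ioo 0 1)) {Φ : (Fin (d + 1) → ℝ) → ℝ} (hΦ : Measurable Φ) {B : ℝ}
    (hB : ∀ u, |Φ u| ≤ B) :
    ∫ S, Φ (upperStats d (g ∘ S)) ∂(Measure.pi fun _ : Fin n => unif)
      = n.descFactorial (d + 1) / (n : ℝ) ^ (d + 1) * ∫ v, (chamber d).indicator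
          (fun v => Φ (g ∘ ((n : ℝ)⁻¹ • v)) * binomialWeight n d (v (Fin.last d))) v := by
  have hn0 : (0 : ℝ) < n := by
    have : 0 < n := by omega
    exact_mod_cast this
  have hinv : (0 : ℝ) < (n : ℝ)⁻¹ := inv_pos.2 hn0
  set f : (Fin (d + 1) → ℝ) → ℝ := (chamber d).indicator fun u =>
    Φ (g ∘ u) * if u (Fin.last d) < 1 then (1 - u (Fin.last d)) ^ (n - (d + 1)) else 0 with hf
  have hright : ∀ v : Fin (d + 1) → ℝ, (chamber d).indicator
      (fun v => Φ (g ∘ ((n : ℝ)⁻¹ • v)) * binomialWeight n d (v (Fin.last d))) v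
        = f ((n : ℝ)⁻¹ • v) := by
    intro v
    by_cases hv : v ∈ chamber d
    · rw [hf, Set.indicator_of_mem hv, Set.indicator_of_mem ((smul_mem_chamber_iff hinv v).2 hv)]
      have : (n : ℝ)⁻¹ * v (Fin.last d) < 1 ↔ v (Fin.last d) < n := by
        rw [inv_mul_lt_iff₀ hn0, mul_one]
      simp only [Pi.smul_apply, smul_eq_mul, this, binomialWeight, div_eq_inv_mul]
    · rw [hf, Set.indicator_of_notMem hv,
        Set.indicator_of_notMem fun h => hv ((smul_mem_chamber_iff hinv v).1 h)]
  have hleft : ∀ u : Fin (d + 1) → ℝ, (Set.univ.pi fun _ => Set.Ioo (0 : ℝ) 1).indicator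
      ({u : Fin (d + 1) → ℝ | StrictMono u}.indicator
          (fun u => Φ (g ∘ u) * unif.real (Set.Ioi (u (Fin.last d))) ^ (n - (d + 1)))) u = f u := by
    intro u
    by_cases hu : u ∈ chamber d ∧ u (Fin.last d) < 1
    · have h1 : u ∈ Set.univ.pi fun _ => Set.Ioo (0 : ℝ) 1 := fun j _ =>
        ⟨pos_of_mem_chamber hu.1 j, (hu.1.1.monotone (Fin.le_last j)).trans_lt hu.2⟩
      have h2 : u ∈ {u : Fin (d + 1) → ℝ | StrictMono u} := hu.1.1
      rw [Set.indicator_of_mem h1, Set.indicator_of_mem h2, hf, Set.indicator_of_mem hu.1,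
        if_pos hu.2, unif_real_Ioi (h1 _ trivial).1 (h1 _ trivial).2]
    · have hzero : f u = 0 := by
        by_cases h1 : u ∈ chamber d
        · rw [hf, Set.indicator_of_mem h1, if_neg fun h => hu ⟨h1, h⟩, mul_zero]
        · rw [hf, Set.indicator_of_notMem h1]
      rw [hzero]
      by_cases h1 : u ∈ Set.univ.pi fun _ => Set.Ioo (0 : ℝ) 1
      · have h2 : u ∉ {u : Fin (d + 1) → ℝ | StrictMono u} := fun h =>
          hu ⟨⟨h, (h1 0 trivial).1⟩, (h1 _ trivial).2⟩
        rw [Set.indicator_of_mem h1, Set.indicator_of_notMem h2]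
      · rw [Set.indicator_of_notMem h1]
  rw [integral_upperStats hn hgm hg hΦ hB, pi_unif,
    ← integral_indicator (MeasurableSet.univ_pi fun _ => measurableSet_Ioo)]
  simp only [hleft, hright]
  rw [Measure.integral_comp_inv_smul_of_nonneg _ _ hn0.le, Module.finrank_fintype_fun_eq_card,
    Fintype.card_fin, smul_eq_mul]
  field_simp

theorem tendsto_binomialWeight (d : ℕ) (t : ℝ) :
    Tendsto (fun n : ℕ => binomialWeight n d t) atTop (𝓝 (Real.exp (-t))) := by
  have h1 := Real.tendsto_one_add_div_pow_exp (-t)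
  have h2 : Tendsto (fun n : ℕ => 1 - t / (n : ℝ)) atTop (𝓝 1) := by
    simpa using (tendsto_const_div_atTop_nhds_zero_nat t).const_sub 1
  have h3 := h1.div (h2.pow (d + 1)) (by simp)
  rw [one_pow, div_one] at h3
  refine h3.congr' ?_
  filter_upwards [h2.eventually_ne one_ne_zero, eventually_ge_atTop (d + 1),
    tendsto_natCast_atTop_atTop.eventually_gt_atTop t] with n hn hd ht
  rw [binomialWeight, if_pos ht, pow_sub₀ _ hn hd, Pi.div_apply, neg_div, ← sub_eq_add_neg,
    div_eq_mul_inv]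

/-- For `n ≥ 2 (d + 1)` the exponent is at least `n / 2`, whence a bound uniform in `n`. -/
theorem binomialWeight_le {n d : ℕ} (hn : 2 * (d + 1) ≤ n) {t : ℝ} (ht : 0 < t) :
    |binomialWeight n d t| ≤ Real.exp (-(t / 2)) := by
  unfold binomialWeight
  split_ifs with h
  · have hn0 : (0 : ℝ) < n := ht.trans h
    have h0 : 0 ≤ 1 - t / n := by
      rw [sub_nonneg, div_le_one hn0]
      exact h.le
    rw [abs_of_nonneg (pow_nonneg h0 _)]
    calc (1 - t / n) ^ (n - (d + 1)) ≤ Real.exp (-(t / n)) ^ (n - (d + 1)) :=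
          pow_le_pow_left₀ h0 (Real.one_sub_le_exp_neg _) _
      _ = Real.exp ((n - (d + 1) : ℕ) * -(t / n)) := (Real.exp_nat_mul _ _).symm
      _ ≤ Real.exp (-(t / 2)) := by
          refine Real.exp_le_exp.2 ?_
          have h2 : (2 * ((d : ℝ) + 1)) ≤ n := by exact_mod_cast hn
          have h3 : (n : ℝ) / 2 * (t / n) ≤ (n - (d + 1) : ℕ) * (t / n) := by
            refine mul_le_mul_of_nonneg_right ?_ (div_pos ht hn0).le
            rw [Nat.cast_sub (by omega)]
            push_cast
            linarith
          have h4 : (n : ℝ) / 2 * (t / n) = t / 2 := by field_simp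
          linarith
  · simpa using (Real.exp_pos _).le

/-- An integrable majorant of `v ↦ exp (-v_d / 2)` on the chamber. -/
noncomputable def majorant (d : ℕ) (v : Fin (d + 1) → ℝ) : ℝ :=
  ∏ j, (Set.Ioi (0 : ℝ)).indicator (fun s => Real.exp (-(1 / (2 * ((d : ℝ) + 1))) * s)) (v j)

theorem integrable_majorant (d : ℕ) : Integrable (majorant d) := by
  refine Integrable.fintype_prod (f := fun _ => (Set.Ioi (0 : ℝ)).indicator
    fun s => Real.exp (-(1 / (2 * ((d : ℝ) + 1))) * s)) fun _ => ?_
  exact (exp_neg_integrableOn_Ioi 0 (by positivity)).integrable_indicator measurableSet_Ioi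

theorem majorant_nonneg (d : ℕ) (v : Fin (d + 1) → ℝ) : 0 ≤ majorant d v :=
  Finset.prod_nonneg fun _ _ => Set.indicator_nonneg (fun _ _ => (Real.exp_pos _).le) _

/-- On the chamber `v_d` dominates the average of the coordinates; sharing the exponent equally
among them yields an integrable product. -/
theorem exp_le_majorant {d : ℕ} {v : Fin (d + 1) → ℝ} (hv : v ∈ chamber d) :
    Real.exp (-(v (Fin.last d) / 2)) ≤ majorant d v := by
  have : majorant d v = Real.exp (∑ j, -(1 / (2 * ((d : ℝ) + 1))) * v j) := by
    rw [Real.exp_sum]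
    exact Finset.prod_congr rfl fun j _ => Set.indicator_of_mem (pos_of_mem_chamber hv j) _
  rw [this, Real.exp_le_exp, ← Finset.mul_sum]
  have hs : ∑ j, v j ≤ ((d : ℝ) + 1) * v (Fin.last d) := by
    have := Finset.sum_le_card_nsmul Finset.univ v (v (Fin.last d))
      fun j _ => hv.1.monotone (Fin.le_last j)
    simpa using this
  have hc : (0 : ℝ) ≤ 1 / (2 * ((d : ℝ) + 1)) := by positivity
  have h1 := mul_le_mul_of_nonneg_left hs hc
  have h2 : 1 / (2 * ((d : ℝ) + 1)) * (((d : ℝ) + 1) * v (Fin.last d)) = v (Fin.last d) / 2 := by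
    field_simp
  linarith

/-- Limit of integrals of functionals of the largest values of `g` at independent uniforms. -/
theorem tendsto_integral_upperStats {d : ℕ} {g : ℝ → ℝ} (hgm : Measurable g)
    (hg : AntitoneOn g (Set.Ioo 0 1)) {Φ : ℕ → (Fin (d + 1) → ℝ) → ℝ}
    (hΦ : ∀ n, Measurable (Φ n)) {B : ℝ} (hB : ∀ n u, |Φ n u| ≤ B) {Ψ : (Fin (d + 1) → ℝ) → ℝ}
    (hlim : ∀ v ∈ chamber d, Tendsto (fun n : ℕ => Φ n (g ∘ ((n : ℝ)⁻¹ • v))) atTop (𝓝 (Ψ v))) :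
    Tendsto (fun n : ℕ => ∫ S, Φ n (upperStats d (g ∘ S)) ∂(Measure.pi fun _ : Fin n => unif))
      atTop (𝓝 (∫ v, (chamber d).indicator (fun v => Ψ v * Real.exp (-v (Fin.last d))) v)) := by
  have hB0 : 0 ≤ B := (abs_nonneg _).trans (hB 0 0)
  have hdesc : Tendsto (fun n : ℕ => (n.descFactorial (d + 1) : ℝ) / (n : ℝ) ^ (d + 1)) atTop
      (𝓝 1) := by
    have h := (isEquivalent_descFactorial (d + 1))
    refine (Asymptotics.isEquivalent_iff_tendsto_one ?_).1 h
    filter_upwards [eventually_gt_atTop 0] with n hn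
    have : (0 : ℝ) < n := Nat.cast_pos.2 hn
    positivity
  have hmeas : ∀ n : ℕ, Measurable fun v : Fin (d + 1) → ℝ =>
      Φ n (g ∘ ((n : ℝ)⁻¹ • v)) * binomialWeight n d (v (Fin.last d)) := by
    intro n
    refine Measurable.mul ((hΦ n).comp (measurable_pi_lambda _ fun j => hgm.comp ?_)) ?_
    · exact (measurable_pi_apply j).const_mul _
    · unfold binomialWeight
      refine Measurable.ite (measurableSet_lt (measurable_pi_apply _) measurable_const) ?_
        measurable_const
      fun_prop
  have hint := tendsto_integral_filter_of_dominated_convergence (μ := volume) (l := atTop)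
    (F := fun (n : ℕ) v => (chamber d).indicator (fun v =>
      Φ n (g ∘ ((n : ℝ)⁻¹ • v)) * binomialWeight n d (v (Fin.last d))) v)
    (f := fun v => (chamber d).indicator (fun v => Ψ v * Real.exp (-v (Fin.last d))) v)
    (fun v => B * majorant d v)
    (Eventually.of_forall fun n =>
      ((hmeas n).indicator (measurableSet_chamber d)).aestronglyMeasurable)
    (by
      filter_upwards [eventually_ge_atTop (2 * (d + 1))] with n hn
      refine Eventually.of_forall fun v => ?_
      by_cases hv : v ∈ chamber d
      · rw [Set.indicator_of_mem hv, norm_mul]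
        exact mul_le_mul (hB _ _) ((binomialWeight_le hn (pos_of_mem_chamber hv _)).trans
          (exp_le_majorant hv)) (norm_nonneg _) hB0
      · rw [Set.indicator_of_notMem hv, norm_zero]
        exact mul_nonneg hB0 (majorant_nonneg d v))
    ((integrable_majorant d).const_mul B)
    (Eventually.of_forall fun v => by
      by_cases hv : v ∈ chamber d
      · simp only [Set.indicator_of_mem hv]
        exact (hlim v hv).mul (tendsto_binomialWeight d _)
      · simp only [Set.indicator_of_notMem hv]
        exact tendsto_const_nhds)
  have h := hdesc.mul hint
  rw [one_mul] at h
  refine h.congr' ?_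
  filter_upwards [eventually_ge_atTop (d + 1)] with n hn
  exact (integral_upperStats_scaled hn hgm hg (hΦ n) (hB n)).symm

/-! ### Partial sums of exponential variables -/

/-- A product of measures with densities with respect to Lebesgue measure has the product
density. -/
theorem pi_withDensity_ofReal {ι : Type*} [Fintype ι] {f : ℝ → ℝ}
    (h0 : ∀ x, 0 ≤ f x) (hint : Integrable f) :
    (Measure.pi fun _ : ι => volume.withDensity fun x => ENNReal.ofReal (f x))
      = volume.withDensity fun x : ι → ℝ => ENNReal.ofReal (∏ i, f (x i)) := by
  have : IsFiniteMeasure (volume.withDensity fun x => ENNReal.ofReal (f x)) :=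
    isFiniteMeasure_withDensity_ofReal hint.2
  refine Measure.pi_eq fun s hs => ?_
  have hs' : ∀ i, Integrable ((s i).indicator f) := fun i => hint.indicator (hs i)
  have hprod : ∀ x : ι → ℝ, (Set.univ.pi s).indicator
      (fun x : ι → ℝ => ENNReal.ofReal (∏ i, f (x i))) x
        = ENNReal.ofReal (∏ i, (s i).indicator f (x i)) := by
    intro x
    by_cases hx : x ∈ Set.univ.pi s
    · rw [Set.indicator_of_mem hx]
      congr 1
      exact Finset.prod_congr rfl fun i _ => (Set.indicator_of_mem (hx i trivial) _).symm
    · rw [Set.indicator_of_notMem hx]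
      obtain ⟨i, hi⟩ : ∃ i, x i ∉ s i := by
        by_contra! h
        exact hx fun i _ => h i
      rw [Finset.prod_eq_zero (Finset.mem_univ i) (Set.indicator_of_notMem hi _),
        ENNReal.ofReal_zero]
  rw [withDensity_apply _ (MeasurableSet.univ_pi hs), ← lintegral_indicator
    (MeasurableSet.univ_pi hs)]
  simp only [hprod]
  have h0' : ∀ i x, 0 ≤ (s i).indicator f x := fun i => Set.indicator_nonneg fun x _ => h0 x
  have hI : Integrable fun x : ι → ℝ => ∏ i, (s i).indicator f (x i) :=
    Integrable.fintype_prod hs'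
  rw [← ofReal_integral_eq_lintegral_ofReal hI
    (Eventually.of_forall fun x => Finset.prod_nonneg fun i _ => h0' i _),
    integral_fintype_prod_volume_eq_prod,
    ENNReal.ofReal_prod_of_nonneg fun i _ => integral_nonneg (h0' i)]
  refine Finset.prod_congr rfl fun i _ => ?_
  rw [ofReal_integral_eq_lintegral_ofReal (hs' i) (Eventually.of_forall (h0' i)),
    withDensity_apply _ (hs i), ← lintegral_indicator (hs i)]
  refine lintegral_congr fun x => ?_
  by_cases hx : x ∈ s i <;> simp [hx]

/-- The matrix of partial summation. -/
def sumMatrix (d : ℕ) : Matrix (Fin (d + 1)) (Fin (d + 1)) ℝ :=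
  Matrix.of fun j i => if i ≤ j then 1 else 0

theorem det_sumMatrix (d : ℕ) : (sumMatrix d).det = 1 := by
  rw [Matrix.det_of_isLowerTriangular]
  · simp [sumMatrix]
  · intro i j hij
    have : i < j := hij
    simp [sumMatrix, this]

theorem toLin'_sumMatrix_apply (d : ℕ) (f : ℕ → ℝ) (j : Fin (d + 1)) :
    Matrix.toLin' (sumMatrix d) (fun i => f i) j = ∑ i ∈ Finset.range (j + 1), f i := by
  have h : ∀ i : Fin (d + 1), sumMatrix d j i * f i = if i ∈ Finset.Iic j then f i else 0 := by
    intro i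
    simp [sumMatrix]
  rw [Matrix.toLin'_apply, Matrix.mulVec, dotProduct]
  simp only [h]
  rw [Finset.sum_ite_mem, Finset.univ_inter, Nat.range_succ_eq_Iic, ← Fin.map_valEmbedding_Iic,
    Finset.sum_map]
  rfl

theorem toLin'_sumMatrix_mem_chamber_iff (d : ℕ) (f : ℕ → ℝ) :
    Matrix.toLin' (sumMatrix d) (fun i => f i) ∈ chamber d ↔ ∀ i : Fin (d + 1), 0 < f i := by
  have h : StrictMono (Matrix.toLin' (sumMatrix d) fun i => f i) ↔
      ∀ i : Fin d, 0 < f (i + 1) := by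
    rw [Fin.strictMono_iff_lt_succ]
    refine forall_congr' fun i => ?_
    rw [toLin'_sumMatrix_apply, toLin'_sumMatrix_apply, Fin.val_castSucc, Fin.val_succ,
      Finset.sum_range_succ _ ((i : ℕ) + 1)]
    simp
  have h0 : Matrix.toLin' (sumMatrix d) (fun i => f i) 0 = f 0 := by
    rw [toLin'_sumMatrix_apply]
    simp
  rw [chamber, Set.mem_ofPred_eq, h, h0, Fin.forall_fin_succ]
  simp [and_comm]

theorem measurePreserving_sumMatrix (d : ℕ) :
    MeasurePreserving (Matrix.toLin' (sumMatrix d)) volume volume := by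
  refine ⟨(LinearMap.continuous_of_finiteDimensional _).measurable, ?_⟩
  rw [Real.map_matrix_volume_pi_eq_smul_volume_pi (by rw [det_sumMatrix]; exact one_ne_zero),
    det_sumMatrix]
  simp

theorem expMeasure_one_eq : expMeasure 1
    = volume.withDensity fun x => ENNReal.ofReal (exponentialPDFReal 1 x) := rfl

theorem integrable_exponentialPDFReal : Integrable (exponentialPDFReal 1) := by
  refine ⟨(measurable_exponentialPDFReal 1).aestronglyMeasurable, ?_⟩
  rw [hasFiniteIntegral_iff_ofReal (Eventually.of_forall (exponentialPDFReal_nonneg one_pos))]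
  have := lintegral_exponentialPDF_eq_one one_pos
  unfold exponentialPDF at this
  rw [this]
  exact ENNReal.one_lt_top

/-- The law of the first partial sums of independent standard exponential variables. -/
theorem integral_partialSums {Ω' : Type*} [MeasurableSpace Ω'] {P' : Measure Ω'}
    [IsProbabilityMeasure P'] {E : ℕ → Ω' → ℝ} (hE_indep : iIndepFun E P')
    (hE_law : ∀ i, HasLaw (E i) (expMeasure 1) P') {d : ℕ} {Ψ : (Fin (d + 1) → ℝ) → ℝ}
    (hΨ : Measurable Ψ) :
    ∫ ω, Ψ (fun j => ∑ i ∈ Finset.range (j + 1), E i ω) ∂P'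
      = ∫ v, (chamber d).indicator (fun v => Ψ v * Real.exp (-v (Fin.last d))) v := by
  have hmeas : ∀ i, AEMeasurable (E i) P' := fun i => (hE_law i).aemeasurable
  have hlaw : P'.map (fun ω (i : Fin (d + 1)) => E i ω)
      = Measure.pi fun _ : Fin (d + 1) => expMeasure 1 := by
    rw [(iIndepFun_iff_map_fun_eq_pi_map fun i : Fin (d + 1) => hmeas i).1
      (hE_indep.precomp Fin.val_injective)]
    congr
    funext i
    exact (hE_law i).map_eq
  have hT := measurePreserving_sumMatrix d
  have hsum : ∀ ω, (fun j : Fin (d + 1) => ∑ i ∈ Finset.range (j + 1), E i ω)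
      = Matrix.toLin' (sumMatrix d) (fun i => E i ω) := fun ω =>
    funext fun j => (toLin'_sumMatrix_apply d (fun i => E i ω) j).symm
  have hpdf : Measurable fun x : Fin (d + 1) → ℝ => ∏ i, exponentialPDFReal 1 (x i) :=
    Finset.measurable_prod _ fun i _ =>
      (measurable_exponentialPDFReal 1).comp (measurable_pi_apply i)
  have hvec : AEMeasurable (fun ω (i : Fin (d + 1)) => E i ω) P' :=
    aemeasurable_pi_lambda _ fun i => hmeas i
  have hindic : Measurable ((chamber d).indicator
      fun v => Ψ v * Real.exp (-v (Fin.last d))) := by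
    refine Measurable.indicator (hΨ.mul ?_) (measurableSet_chamber d)
    fun_prop
  simp only [hsum]
  rw [← integral_map (f := fun e => Ψ (Matrix.toLin' (sumMatrix d) e)) hvec
    (hΨ.comp hT.measurable).aestronglyMeasurable, hlaw, expMeasure_one_eq,
    pi_withDensity_ofReal
      (exponentialPDFReal_nonneg one_pos) integrable_exponentialPDFReal,
    integral_withDensity_eq_integral_toReal_smul hpdf.ennreal_ofReal
      (Eventually.of_forall fun _ => ENNReal.ofReal_lt_top)]
  conv_rhs => rw [← hT.map_eq]
  rw [integral_map hT.measurable.aemeasurable hindic.aestronglyMeasurable]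
  -- The exponential density is positive at `0` whereas the chamber asks for strict inequalities;
  -- the two sides agree off the coordinate hyperplanes.
  have hne : ∀ᵐ e : Fin (d + 1) → ℝ, ∀ i, e i ≠ 0 := by
    rw [ae_all_iff]
    exact fun i => Measure.ae_eval_ne _ i 0
  refine integral_congr_ae (hne.mono fun e he => ?_)
  -- Extension by zero to a sequence, the form needed for sums over `Finset.range`.
  set f : ℕ → ℝ := fun i => if h : i < d + 1 then e ⟨i, h⟩ else 0 with hf
  have hfi : ∀ i : Fin (d + 1), f i = e i := fun i => dif_pos i.isLt
  have hfe : e = fun i : Fin (d + 1) => f i := funext fun i => (hfi i).symm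
  beta_reduce
  rw [ENNReal.toReal_ofReal (Finset.prod_nonneg fun i _ => exponentialPDFReal_nonneg one_pos _),
    smul_eq_mul]
  by_cases hpos : ∀ i : Fin (d + 1), 0 < f i
  · have hmem : Matrix.toLin' (sumMatrix d) e ∈ chamber d := by
      rw [hfe]
      exact (toLin'_sumMatrix_mem_chamber_iff d f).2 hpos
    have hlast : Matrix.toLin' (sumMatrix d) e (Fin.last d) = ∑ i, e i := by
      conv_lhs => rw [hfe]
      rw [toLin'_sumMatrix_apply, Fin.val_last, Finset.sum_range]
      simp only [hfi]
    rw [Set.indicator_of_mem hmem, hlast, mul_comm, ← Finset.sum_neg_distrib, Real.exp_sum]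
    congr 1
    refine Finset.prod_congr rfl fun i _ => ?_
    have : 0 ≤ e i := (hfi i) ▸ (hpos i).le
    simp [exponentialPDFReal, gammaPDFReal, this]
  · have hmem : Matrix.toLin' (sumMatrix d) e ∉ chamber d := by
      rw [hfe]
      exact fun h => hpos ((toLin'_sumMatrix_mem_chamber_iff d f).1 h)
    rw [Set.indicator_of_notMem hmem]
    push Not at hpos
    obtain ⟨i, hi⟩ := hpos
    have : e i < 0 := lt_of_le_of_ne (hfi i ▸ hi) (he i)
    rw [Finset.prod_eq_zero (Finset.mem_univ i), zero_mul]
    simp [exponentialPDFReal, gammaPDFReal, this]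

/-! ### Scores and their quantile transform -/

open Classical in
/-- The exponential of the output if the input is at most `x`, and `0` otherwise. -/
noncomputable def score {p : ℕ} (x : Fin p → ℝ) (z : (Fin p → ℝ) × ℝ) : ℝ :=
  if z.1 ≤ x then Real.exp z.2 else 0

theorem measurable_score {p : ℕ} (x : Fin p → ℝ) : Measurable (score x) :=
  Measurable.ite (measurableSet_le measurable_fst measurable_const)
    (Real.measurable_exp.comp measurable_snd) measurable_const

theorem lt_score_iff {p : ℕ} (x : Fin p → ℝ) (z : (Fin p → ℝ) × ℝ) {t : ℝ} (ht : 0 < t) :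
    t < score x z ↔ z.1 ≤ x ∧ Real.log t < z.2 := by
  unfold score
  split_ifs with h
  · simp [h, Real.log_lt_iff_lt_exp ht]
  · simp [h, ht.le]

theorem le_score_iff {p : ℕ} (x : Fin p → ℝ) (z : (Fin p → ℝ) × ℝ) {t : ℝ} (ht : 0 < t) :
    t ≤ score x z ↔ z.1 ≤ x ∧ Real.log t ≤ z.2 := by
  unfold score
  split_ifs with h
  · simp [h, Real.log_le_iff_le_exp ht]
  · simp [h, ht]

/-- The transformation which maps the uniform distribution to the distribution of the score. -/
noncomputable def scoreQuantile (F : ℝ → ℝ) (p₀ s : ℝ) : ℝ :=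
  if 0 < s ∧ s < p₀ then Real.exp (quantile F (1 - s / p₀)) else 0

section

variable {F : ℝ → ℝ} (hF : IsDistFun F) {p₀ : ℝ} (hp₀ : 0 < p₀)
include hF hp₀

/-- Superlevel sets are intervals starting at `0`; this yields both measurability and the law under
`unif`. -/
theorem lt_scoreQuantile_iff {t : ℝ} (ht : 0 < t) (s : ℝ) :
    t < scoreQuantile F p₀ s ↔ 0 < s ∧ s < p₀ * (1 - F (Real.log t)) := by
  have hF0 := hF.nonneg (Real.log t)
  unfold scoreQuantile
  split_ifs with h
  · have h1 : 0 < s / p₀ := div_pos h.1 hp₀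
    have h2 : s / p₀ < 1 := (div_lt_one hp₀).2 h.2
    have := hF.quantile_le_iff (τ := 1 - s / p₀) (by linarith) (by linarith) (Real.log t)
    rw [← Real.log_lt_iff_lt_exp ht, ← not_le, this, not_le, ← div_lt_iff₀' hp₀]
    constructor
    · intro h'; exact ⟨h.1, by linarith⟩
    · intro h'; linarith [h'.2]
  · refine ⟨fun h' => absurd h' (not_lt.2 ht.le), fun h' => absurd ⟨h'.1, h'.2.trans_le ?_⟩ h⟩
    nlinarith

omit hF hp₀ in
theorem zero_lt_scoreQuantile_iff (s : ℝ) : 0 < scoreQuantile F p₀ s ↔ 0 < s ∧ s < p₀ := by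
  unfold scoreQuantile
  split_ifs with h
  · exact ⟨fun _ => h, fun _ => Real.exp_pos _⟩
  · simp [h]

omit hF hp₀ in
theorem scoreQuantile_nonneg (s : ℝ) : 0 ≤ scoreQuantile F p₀ s := by
  unfold scoreQuantile
  split_ifs
  exacts [(Real.exp_pos _).le, le_rfl]

theorem measurable_scoreQuantile : Measurable (scoreQuantile F p₀) := by
  refine measurable_of_Ioi fun t => ?_
  rcases lt_trichotomy t 0 with ht | rfl | ht
  · have : scoreQuantile F p₀ ⁻¹' Set.Ioi t = Set.univ :=
      Set.eq_univ_of_forall fun s => ht.trans_le (scoreQuantile_nonneg s)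
    rw [this]
    exact MeasurableSet.univ
  · have : scoreQuantile F p₀ ⁻¹' Set.Ioi 0 = Set.Ioo 0 p₀ :=
      Set.ext fun s => zero_lt_scoreQuantile_iff s
    rw [this]
    exact measurableSet_Ioo
  · have : scoreQuantile F p₀ ⁻¹' Set.Ioi t = Set.Ioo 0 (p₀ * (1 - F (Real.log t))) :=
      Set.ext fun s => lt_scoreQuantile_iff hF hp₀ ht s
    rw [this]
    exact measurableSet_Ioo

theorem antitoneOn_scoreQuantile : AntitoneOn (scoreQuantile F p₀) (Set.Ioo 0 1) := by
  intro s hs t ht hst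
  by_cases h : t < p₀
  · have h1 : t / p₀ < 1 := (div_lt_one hp₀).2 h
    have h2 : 0 < s / p₀ := div_pos hs.1 hp₀
    have h3 : s / p₀ ≤ t / p₀ := div_le_div_of_nonneg_right hst hp₀.le
    rw [scoreQuantile, scoreQuantile, if_pos ⟨ht.1, h⟩, if_pos ⟨hs.1, hst.trans_lt h⟩,
      Real.exp_le_exp]
    exact hF.quantile_mono (by linarith) (by linarith) (by linarith)
  · rw [scoreQuantile, if_neg fun h' => h h'.2]
    exact scoreQuantile_nonneg s

omit hF in
-- The source of the factor `1 / p₀` inside `η` in the limit.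
theorem log_scoreQuantile {n : ℕ} {s : ℝ} (hn : (0 : ℝ) < n) (h0 : 0 < s) (h1 : s / p₀ < n) :
    Real.log (scoreQuantile F p₀ ((n : ℝ)⁻¹ * s)) = endpoint F - gap F (s / p₀ / n) := by
  have h2 : (n : ℝ)⁻¹ * s < p₀ := by
    rw [div_lt_iff₀ hp₀] at h1
    rwa [inv_mul_lt_iff₀ hn]
  rw [scoreQuantile, if_pos ⟨by positivity, h2⟩, Real.log_exp, gap]
  have : (n : ℝ)⁻¹ * s / p₀ = s / p₀ / n := by field_simp
  rw [this]
  ring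

end

section

variable {Ω : Type*} [MeasurableSpace Ω] {P : Measure Ω} [IsProbabilityMeasure P] {p : ℕ}
  {x : Fin p → ℝ}

theorem isDistFun_condDistFun {X : Ω → Fin p → ℝ} {Y : Ω → ℝ} (hY : Measurable Y)
    (hpos : 0 < P.real {ω | X ω ≤ x}) : IsDistFun (condDistFun P X Y x) := by
  have hne : P {ω | X ω ≤ x} ≠ 0 := fun h => by simp [measureReal_def, h] at hpos
  have : IsProbabilityMeasure (cond P {ω | X ω ≤ x}) := cond_isProbabilityMeasure hne
  have : IsProbabilityMeasure ((cond P {ω | X ω ≤ x}).map Y) :=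
    Measure.isProbabilityMeasure_map hY.aemeasurable
  have h : condDistFun P X Y x = cdf ((cond P {ω | X ω ≤ x}).map Y) := by
    funext y
    rw [cdf_eq_real, map_measureReal_apply hY measurableSet_Iic]
    rfl
  rw [h]
  exact isDistFun_cdf _

omit [IsProbabilityMeasure P] in
theorem mul_condDistFun {X : Ω → Fin p → ℝ} {Y : Ω → ℝ} (hX : Measurable X)
    (hpos : 0 < P.real {ω | X ω ≤ x}) (y : ℝ) :
    P.real {ω | X ω ≤ x} * condDistFun P X Y x y = P.real ({ω | X ω ≤ x} ∩ {ω | Y ω ≤ y}) := by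
  rw [condDistFun, measureReal_def (cond _ _), cond_apply (measurableSet_le hX measurable_const),
    ENNReal.toReal_mul, ENNReal.toReal_inv]
  exact mul_inv_cancel_left₀ hpos.ne' _

/-- Both laws give `Ioi t` mass `1` for `t < 0`, `p₀` for `t = 0`, and `p₀ (1 - F (log t))` for `t >
0`. -/
theorem map_score {X : Ω → Fin p → ℝ} {Y : Ω → ℝ} (hX : Measurable X) (hY : Measurable Y)
    (hpos : 0 < P.real {ω | X ω ≤ x}) :
    P.map (fun ω => score x (X ω, Y ω))
      = unif.map (scoreQuantile (condDistFun P X Y x) (P.real {ω | X ω ≤ x})) := by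
  set A := {ω | X ω ≤ x} with hA
  set F := condDistFun P X Y x with hFdef
  have hF : IsDistFun F := isDistFun_condDistFun hY hpos
  have hAm : MeasurableSet A := measurableSet_le hX measurable_const
  have hs : Measurable fun ω => score x (X ω, Y ω) := (measurable_score x).comp (hX.prodMk hY)
  have hg := measurable_scoreQuantile hF hpos
  have hone : P.real A ≤ 1 := measureReal_le_one
  have : IsProbabilityMeasure (P.map fun ω => score x (X ω, Y ω)) :=
    Measure.isProbabilityMeasure_map hs.aemeasurable
  have : IsProbabilityMeasure (unif.map (scoreQuantile F (P.real A))) :=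
    Measure.isProbabilityMeasure_map hg.aemeasurable
  have hunif : ∀ b : ℝ, 0 ≤ b → b ≤ 1 → unif.real (Set.Ioo 0 b) = b := fun b h0 h1 => by
    rw [unif, measureReal_restrict_apply measurableSet_Ioo,
      Set.inter_eq_left.2 (Set.Ioo_subset_Ioo_right h1), Real.volume_real_Ioo_of_le h0, sub_zero]
  have hIoi : ∀ t, (P.map fun ω => score x (X ω, Y ω)).real (Set.Ioi t)
      = (unif.map (scoreQuantile F (P.real A))).real (Set.Ioi t) := by
    intro t
    rw [map_measureReal_apply hs measurableSet_Ioi, map_measureReal_apply hg measurableSet_Ioi]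
    rcases lt_trichotomy t 0 with ht | rfl | ht
    · have h1 : (fun ω => score x (X ω, Y ω)) ⁻¹' Set.Ioi t = Set.univ :=
        Set.eq_univ_of_forall fun ω => by
          refine ht.trans_le ?_
          change 0 ≤ score x _
          unfold score
          split_ifs
          exacts [(Real.exp_pos _).le, le_rfl]
      have h2 : scoreQuantile F (P.real A) ⁻¹' Set.Ioi t = Set.univ :=
        Set.eq_univ_of_forall fun s => ht.trans_le (scoreQuantile_nonneg s)
      rw [h1, h2]
      simp
    · have h1 : (fun ω => score x (X ω, Y ω)) ⁻¹' Set.Ioi 0 = A := by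
        ext ω
        by_cases h : X ω ≤ x <;> simp [score, hA, h, Real.exp_pos]
      have h2 : scoreQuantile F (P.real A) ⁻¹' Set.Ioi 0 = Set.Ioo 0 (P.real A) :=
        Set.ext fun s => zero_lt_scoreQuantile_iff s
      rw [h1, h2, hunif _ hpos.le hone]
    · have h1 : (fun ω => score x (X ω, Y ω)) ⁻¹' Set.Ioi t
          = A \ (A ∩ {ω | Y ω ≤ Real.log t}) := by
        ext ω
        have := lt_score_iff x (X ω, Y ω) ht
        simp only [Set.mem_preimage, Set.mem_Ioi, this, Set.sdiff_self_inter, hA]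
        simp
      have h2 : scoreQuantile F (P.real A) ⁻¹' Set.Ioi t
          = Set.Ioo 0 (P.real A * (1 - F (Real.log t))) :=
        Set.ext fun s => lt_scoreQuantile_iff hF hpos ht s
      have h3 := hF.le_one (Real.log t)
      have h4 := hF.nonneg (Real.log t)
      rw [h1, h2, hunif _ (mul_nonneg hpos.le (by linarith)) (by nlinarith),
        measureReal_sdiff Set.inter_subset_left
          (hAm.inter (measurableSet_le hY measurable_const)), ← mul_condDistFun hX hpos]
      ring
  refine Measure.ext_of_Iic _ _ fun t => ?_
  have h := hIoi t
  rw [← Set.compl_Iic, measureReal_compl measurableSet_Iic, measureReal_compl measurableSet_Iic,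
    probReal_univ, probReal_univ, sub_right_inj] at h
  exact (ENNReal.toReal_eq_toReal_iff' (measure_ne_top _ _) (measure_ne_top _ _)).1 h

/-- The joint law of the scores of an i.i.d. sample. -/
theorem map_scores {X : ℕ → Ω → Fin p → ℝ} {Y : ℕ → Ω → ℝ} (hX : ∀ i, Measurable (X i))
    (hY : ∀ i, Measurable (Y i)) (hindep : iIndepFun (fun i ω => (X i ω, Y i ω)) P)
    (hident : ∀ i, IdentDistrib (fun ω => (X i ω, Y i ω)) (fun ω => (X 0 ω, Y 0 ω)) P P)
    (hpos : 0 < P.real {ω | X 0 ω ≤ x}) (n : ℕ) :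
    P.map (fun ω (i : Fin n) => score x (X i ω, Y i ω))
      = (Measure.pi fun _ : Fin n => unif).map fun S =>
        scoreQuantile (condDistFun P (X 0) (Y 0) x) (P.real {ω | X 0 ω ≤ x}) ∘ S := by
  have hs := measurable_score x
  have hg := measurable_scoreQuantile (isDistFun_condDistFun (hY 0) hpos) hpos
  have hind : iIndepFun (fun (i : Fin n) ω => score x (X i ω, Y i ω)) P :=
    (hindep.comp (fun _ => score x) fun _ => hs).precomp Fin.val_injective
  have hm : ∀ i : Fin n, Measurable fun ω => score x (X i ω, Y i ω) :=
    fun i => hs.comp ((hX i).prodMk (hY i))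
  rw [(iIndepFun_iff_map_fun_eq_pi_map fun i => (hm i).aemeasurable).1 hind]
  have : IsProbabilityMeasure (unif.map
      (scoreQuantile (condDistFun P (X 0) (Y 0) x) (P.real {ω | X 0 ω ≤ x}))) :=
    Measure.isProbabilityMeasure_map hg.aemeasurable
  have h := Measure.pi_map_pi (μ := fun _ : Fin n => unif)
    (f := fun _ => scoreQuantile (condDistFun P (X 0) (Y 0) x) (P.real {ω | X 0 ω ≤ x}))
    fun _ => hg.aemeasurable
  refine Eq.trans ?_ h.symm
  congr
  funext i
  rw [← map_score (hX 0) (hY 0) hpos]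
  exact ((hident i).comp hs).map_eq

end

/-! ### Optimality conditions for the check function -/

theorem checkFun_sub_of_lt {τ u ε : ℝ} (hu : ε < u) (hε : 0 < ε) :
    checkFun τ (u - ε) - checkFun τ u = -(τ * ε) := by
  rw [checkFun, checkFun, if_neg (by linarith), if_neg (by linarith)]
  ring

theorem checkFun_sub_of_nonpos {τ u ε : ℝ} (hu : u ≤ 0) (hε : 0 < ε) :
    checkFun τ (u - ε) - checkFun τ u = (1 - τ) * ε := by
  rw [checkFun, checkFun, if_pos (by linarith), if_pos hu]
  ring

theorem checkFun_add_of_nonneg {τ u ε : ℝ} (hu : 0 ≤ u) (hε : 0 < ε) :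
    checkFun τ (u + ε) - checkFun τ u = τ * ε := by
  rcases hu.eq_or_lt with rfl | hu
  · rw [checkFun, checkFun, if_neg (by linarith), if_pos le_rfl]
    ring
  · rw [checkFun, checkFun, if_neg (by linarith), if_neg (by linarith)]
    ring

theorem checkFun_add_of_lt {τ u ε : ℝ} (hu : u < -ε) (hε : 0 < ε) :
    checkFun τ (u + ε) - checkFun τ u = -((1 - τ) * ε) := by
  rw [checkFun, checkFun, if_pos (by linarith), if_pos (by linarith)]
  ring

theorem eventually_nhdsGT_forall_lt {ι : Type*} (s : Finset ι) (u : ι → ℝ) :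
    ∀ᶠ ε : ℝ in 𝓝[>] 0, 0 < ε ∧ ∀ i ∈ s, 0 < u i → ε < u i := by
  refine (eventually_mem_nhdsWithin (s := Set.Ioi (0 : ℝ))).and ?_
  refine (Finset.eventually_all s).2 fun i _ => ?_
  by_cases h : 0 < u i
  · filter_upwards [Ioo_mem_nhdsGT h] with ε hε _ using hε.2
  · exact Eventually.of_forall fun ε h' => absurd h' h

/-- Optimality conditions for a sample quantile in terms of counts. -/
theorem counts_of_isMinOn {ι : Type*} [DecidableEq ι] (s : Finset ι) (y : ι → ℝ) {τ q : ℝ}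
    (h : IsMinOn (fun q => ∑ i ∈ s, checkFun τ (y i - q)) Set.univ q) :
    ((s.filter fun i => q < y i).card : ℝ) ≤ (1 - τ) * s.card ∧
      (1 - τ) * s.card ≤ ((s.filter fun i => q ≤ y i).card : ℝ) := by
  have hcount : ∀ r : ι → Prop, ∀ [DecidablePred r],
      ∑ i ∈ s, (if r i then (1 : ℝ) else 0) = (s.filter r).card := fun r _ => by
    rw [Finset.sum_boole]
  constructor
  -- The step `ε` is too small to cross an observation, so the objective is affine along it and its
  -- increment is `ε` times a difference of counts.
  · obtain ⟨ε, hε, hs⟩ := (eventually_nhdsGT_forall_lt s fun i => y i - q).exists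
    have hmin := h (Set.mem_univ (q + ε))
    have hdiff : ∑ i ∈ s, checkFun τ (y i - (q + ε)) - ∑ i ∈ s, checkFun τ (y i - q)
        = ε * ((1 - τ) * s.card - (s.filter fun i => q < y i).card) := by
      rw [← Finset.sum_sub_distrib, ← hcount, mul_sub, Finset.mul_sum, mul_comm (1 - τ),
        ← nsmul_eq_mul, ← Finset.sum_const, Finset.mul_sum, ← Finset.sum_sub_distrib]
      refine Finset.sum_congr rfl fun i hi => ?_
      rw [← sub_sub]
      split_ifs with hq
      · rw [checkFun_sub_of_lt (hs i hi (sub_pos.2 hq)) hε]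
        ring
      · rw [checkFun_sub_of_nonpos (by linarith) hε]
        ring
    have h0 : 0 ≤ ε * ((1 - τ) * s.card - (s.filter fun i => q < y i).card) := by
      rw [← hdiff]
      exact sub_nonneg.2 hmin
    linarith [nonneg_of_mul_nonneg_right h0 hε]
  · obtain ⟨ε, hε, hs⟩ := (eventually_nhdsGT_forall_lt s fun i => q - y i).exists
    have hmin := h (Set.mem_univ (q - ε))
    have hdiff : ∑ i ∈ s, checkFun τ (y i - (q - ε)) - ∑ i ∈ s, checkFun τ (y i - q)
        = ε * ((s.filter fun i => q ≤ y i).card - (1 - τ) * s.card) := by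
      rw [← Finset.sum_sub_distrib, ← hcount, mul_sub, Finset.mul_sum, mul_comm (1 - τ),
        ← nsmul_eq_mul, ← Finset.sum_const, Finset.mul_sum, ← Finset.sum_sub_distrib]
      refine Finset.sum_congr rfl fun i hi => ?_
      rw [← sub_add]
      split_ifs with hq
      · rw [checkFun_add_of_nonneg (by linarith) hε]
        ring
      · have := hs i hi (by linarith)
        rw [checkFun_add_of_lt (by linarith) hε]
        ring
    have h0 : 0 ≤ ε * ((s.filter fun i => q ≤ y i).card - (1 - τ) * s.card) := by
      rw [← hdiff]
      exact sub_nonneg.2 hmin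
    linarith [nonneg_of_mul_nonneg_right h0 hε]

/-! ### Extreme quantile estimators as upper order statistics -/

section

variable {Ω : Type*} {p : ℕ} {x : Fin p → ℝ} {X : ℕ → Ω → Fin p → ℝ} {Y : ℕ → Ω → ℝ}

open Classical in
/-- The number of observations among the first `n` with input at most `x`. -/
noncomputable def effectiveSize (X : ℕ → Ω → Fin p → ℝ) (x : Fin p → ℝ) (n : ℕ) (ω : Ω) : ℝ :=
  ∑ i ∈ Finset.range n, if X i ω ≤ x then 1 else 0

/-- Because `(1 - τ) N` lies strictly between `h - 1` and `h`, the optimality bounds leave fewer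
than `h` observations above `q` and at least `h` at or above it. All minimizers therefore coincide.
-/
theorem exp_eq_upperStat_of_isMinOn {n h : ℕ} {τ q : ℝ} {ω : Ω}
    (hmin : IsMinOn (objective X Y x n τ ω) Set.univ q)
    (h1 : (h : ℝ) - 1 < (1 - τ) * effectiveSize X x n ω)
    (h2 : (1 - τ) * effectiveSize X x n ω < h) :
    Real.exp q = upperStat h fun i : Fin n => score x (X i ω, Y i ω) := by
  classical
  set s := Finset.univ.filter fun i : Fin n => X i ω ≤ x with hs
  have hobj : objective X Y x n τ ω = fun q => ∑ i ∈ s, checkFun τ (Y i ω - q) := by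
    funext q
    rw [objective, Finset.sum_range, hs, Finset.sum_filter]
    exact Finset.sum_congr rfl fun i _ => by split_ifs <;> simp
  have hsize : effectiveSize X x n ω = s.card := by
    rw [effectiveSize, Finset.sum_range, Finset.sum_boole]
  rw [hobj] at hmin
  obtain ⟨hc1, hc2⟩ := counts_of_isMinOn s (fun i => Y i ω) hmin
  rw [← hsize] at hc1 hc2
  have hgt : countIn (fun i : Fin n => score x (X i ω, Y i ω)) (Set.Ioi (Real.exp q))
      = (s.filter fun i : Fin n => q < Y i ω).card := by
    unfold countIn
    rw [hs, Finset.filter_filter]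
    congr 1
    ext i
    have := lt_score_iff x (X i ω, Y i ω) (Real.exp_pos q)
    rw [Real.log_exp] at this
    simp [this]
  have hge : countIn (fun i : Fin n => score x (X i ω, Y i ω)) (Set.Ici (Real.exp q))
      = (s.filter fun i : Fin n => q ≤ Y i ω).card := by
    unfold countIn
    rw [hs, Finset.filter_filter]
    congr 1
    ext i
    have := le_score_iff x (X i ω, Y i ω) (Real.exp_pos q)
    rw [Real.log_exp] at this
    simp [this]
  refine (upperStat_eq ?_ ?_).symm
  · rw [hge]
    have : (h : ℝ) < (s.filter fun i : Fin n => q ≤ Y i ω).card + 1 := by linarith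
    exact Nat.lt_succ_iff.1 (by exact_mod_cast this)
  · rw [hgt]
    exact_mod_cast hc1.trans_lt h2

variable [MeasurableSpace Ω] {P : Measure Ω} [IsProbabilityMeasure P]

theorem ae_tendsto_effectiveSize (hX : ∀ i, Measurable (X i))
    (hindep : iIndepFun (fun i ω => (X i ω, Y i ω)) P)
    (hident : ∀ i, IdentDistrib (fun ω => (X i ω, Y i ω)) (fun ω => (X 0 ω, Y 0 ω)) P P) :
    ∀ᵐ ω ∂P, Tendsto (fun n : ℕ => effectiveSize X x n ω / n) atTop
      (𝓝 (P.real {ω | X 0 ω ≤ x})) := by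
  classical
  set f : (Fin p → ℝ) × ℝ → ℝ := fun z => if z.1 ≤ x then 1 else 0 with hf
  have hset : MeasurableSet {z : (Fin p → ℝ) × ℝ | z.1 ≤ x} :=
    measurableSet_le measurable_fst measurable_const
  have hfm : Measurable f := Measurable.ite hset measurable_const measurable_const
  have hf0 : (fun ω => f (X 0 ω, Y 0 ω)) = {ω | X 0 ω ≤ x}.indicator fun _ => 1 := by
    funext ω
    simp [hf, Set.indicator_apply]
  have hA : MeasurableSet {ω | X 0 ω ≤ x} := measurableSet_le (hX 0) measurable_const
  have h := strong_law_ae_real (μ := P) (fun i ω => f (X i ω, Y i ω))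
    (by
      rw [hf0]
      exact (integrable_const 1).indicator hA)
    (fun i j hij => (hindep.indepFun hij).comp hfm hfm) fun i => (hident i).comp hfm
  have hE : ∫ ω, f (X 0 ω, Y 0 ω) ∂P = P.real {ω | X 0 ω ≤ x} := by
    rw [hf0, integral_indicator_const _ hA, smul_eq_mul, mul_one]
  rw [hE] at h
  filter_upwards [h] with ω hω
  refine hω.congr fun n => ?_
  simp only [effectiveSize, hf]

/-- Almost surely, the extreme quantile estimator eventually is an upper order statistic. -/
theorem ae_eventually_exp_eq_upperStat (hX : ∀ i, Measurable (X i))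
    (hindep : iIndepFun (fun i ω => (X i ω, Y i ω)) P)
    (hident : ∀ i, IdentDistrib (fun ω => (X i ω, Y i ω)) (fun ω => (X 0 ω, Y 0 ω)) P P)
    {p₀ : ℝ} (hp₀ : p₀ = P.real {ω | X 0 ω ≤ x}) (hp₀_pos : 0 < p₀)
    {qhat : ℕ → ℝ → Ω → ℝ} (hqhat : IsQuantileEstimator P X Y x qhat)
    {κ : ℝ} (hκ : Admissible p₀ κ) :
    ∀ᵐ ω ∂P, ∀ᶠ n : ℕ in atTop, Real.exp (qhat n (level κ n) ω)
      = upperStat (hIndex p₀ κ) fun i : Fin n => score x (X i ω, Y i ω) := by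
  have hmin : ∀ᵐ ω ∂P, ∀ n : ℕ, κ < n →
      IsMinOn (objective X Y x n (level κ n) ω) Set.univ (qhat n (level κ n) ω) := by
    rw [ae_all_iff]
    intro n
    by_cases hn : κ < n
    · have hn0 : (0 : ℝ) < n := hκ.1.trans hn
      have h1 : 0 < κ / n := div_pos hκ.1 hn0
      have h2 : κ / n < 1 := (div_lt_one hn0).2 hn
      filter_upwards [hqhat.isMinOn n (level κ n) (by unfold level; linarith)
        (by unfold level; linarith)] with ω hω _ using hω
    · exact Eventually.of_forall fun ω h => absurd h hn
  have hpos : 0 < κ * p₀ := mul_pos hκ.1 hp₀_pos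
  have hh1 : (hIndex p₀ κ : ℝ) - 1 < κ * p₀ := by
    have := Nat.ceil_lt_add_one hpos.le
    unfold hIndex
    linarith
  have hh2 : κ * p₀ < hIndex p₀ κ :=
    -- Non-integrality of `κ p₀` makes this strict, so the almost sure limit lies in an open
    -- interval and `κ N / n` eventually does too.
    lt_of_le_of_ne (Nat.le_ceil _) fun h => hκ.2 (hIndex p₀ κ) (by exact_mod_cast h)
  filter_upwards [hmin, ae_tendsto_effectiveSize (x := x) hX hindep hident] with ω hω hlim
  rw [← hp₀] at hlim
  have hlim' := hlim.const_mul κ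
  filter_upwards [hlim'.eventually_const_lt hh1, hlim'.eventually_lt_const hh2,
    tendsto_natCast_atTop_atTop.eventually_gt_atTop κ] with n h1 h2 hn
  have e : (1 - level κ n) * effectiveSize X x n ω = κ * (effectiveSize X x n ω / n) := by
    unfold level
    ring
  exact exp_eq_upperStat_of_isMinOn (hω n hn) (by rwa [e]) (by rwa [e])

end

/-! ### Joint convergence of the normalized estimators -/

theorem hIndex_pos {p₀ k : ℝ} (hp₀ : 0 < p₀) (hk : 0 < k) : 0 < hIndex p₀ k :=
  Nat.ceil_pos.2 (mul_pos hk hp₀)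

theorem measurable_eta (ξ : ℝ) : Measurable (eta ξ) :=
  measurable_id.pow_const (-ξ)

/-- The normalized upper order statistics, as a function of the largest scores, together with
the normalized centering constants. -/
noncomputable def normalized (F : ℝ → ℝ) {d L : ℕ} (j₀ jm : Fin (d + 1)) (j : Fin L → Fin (d + 1))
    (k : Fin L → ℝ) (n : ℕ) (y : Fin (d + 1) → ℝ) (l : Fin L) : ℝ × ℝ :=
  ((Real.log (y j₀) - Real.log (y jm))⁻¹ * (Real.log (y (j l)) - endpoint F),
    (Real.log (y j₀) - Real.log (y jm))⁻¹ * (quantile F (level (k l) n) - endpoint F))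

/-- The limit of the normalized order statistics, as a function of exponential partial sums. -/
noncomputable def normalizedLimit (p₀ ξ : ℝ) {d L : ℕ} (j₀ jm : Fin (d + 1))
    (j : Fin L → Fin (d + 1)) (k : Fin L → ℝ) (v : Fin (d + 1) → ℝ) (l : Fin L) : ℝ × ℝ :=
  ((-eta ξ (v j₀ / p₀) - -eta ξ (v jm / p₀))⁻¹ * -eta ξ (v (j l) / p₀),
    (-eta ξ (v j₀ / p₀) - -eta ξ (v jm / p₀))⁻¹ * -eta ξ (k l))

theorem measurable_normalized (F : ℝ → ℝ) {d L : ℕ} (j₀ jm : Fin (d + 1))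
    (j : Fin L → Fin (d + 1)) (k : Fin L → ℝ) (n : ℕ) :
    Measurable (normalized F j₀ jm j k n) := by
  have h : ∀ i : Fin (d + 1), Measurable fun y : Fin (d + 1) → ℝ => Real.log (y i) := fun i =>
    Real.measurable_log.comp (measurable_pi_apply i)
  refine measurable_pi_lambda _ fun l => ?_
  exact (((h j₀).sub (h jm)).inv.mul ((h (j l)).sub_const _)).prodMk
    (((h j₀).sub (h jm)).inv.mul_const _)

theorem measurable_normalizedLimit (p₀ ξ : ℝ) {d L : ℕ} (j₀ jm : Fin (d + 1))
    (j : Fin L → Fin (d + 1)) (k : Fin L → ℝ) : Measurable (normalizedLimit p₀ ξ j₀ jm j k) := by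
  have h : ∀ i : Fin (d + 1), Measurable fun v : Fin (d + 1) → ℝ => -eta ξ (v i / p₀) := fun i => by
    have h1 : Measurable fun v : Fin (d + 1) → ℝ => v i / p₀ := by fun_prop
    exact ((measurable_eta ξ).comp h1).neg
  refine measurable_pi_lambda _ fun l => ?_
  exact (((h j₀).sub (h jm)).inv.mul (h (j l))).prodMk (((h j₀).sub (h jm)).inv.mul_const _)

/-- The endpoint cancels in the spacing, and `gap F (1 / n)` cancels between the spacing and the
deviation. As `v` is strictly increasing and `j₀ < jm`, the limiting spacing is nonzero. -/
theorem tendsto_normalized {F : ℝ → ℝ} {ξ : ℝ} (hF : IsDistFun F) (hξ : InTypeThreeDomain F ξ)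
    {p₀ : ℝ} (hp₀ : 0 < p₀) {d L : ℕ} {j₀ jm : Fin (d + 1)} (hj : j₀ < jm)
    (j : Fin L → Fin (d + 1)) {k : Fin L → ℝ} (hk : ∀ l, 0 < k l) {v : Fin (d + 1) → ℝ}
    (hv : v ∈ chamber d) :
    Tendsto (fun n : ℕ => normalized F j₀ jm j k n (scoreQuantile F p₀ ∘ ((n : ℝ)⁻¹ • v))) atTop
      (𝓝 (normalizedLimit p₀ ξ j₀ jm j k v)) := by
  have hpos : ∀ i, 0 < v i / p₀ := fun i => div_pos (pos_of_mem_chamber hv i) hp₀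
  have hlog : ∀ i, ∀ᶠ n : ℕ in atTop, Real.log (scoreQuantile F p₀ ((n : ℝ)⁻¹ * v i))
      = endpoint F - gap F (v i / p₀ / n) := fun i => by
    filter_upwards [tendsto_natCast_atTop_atTop.eventually_gt_atTop (v i / p₀)] with n hn
    exact log_scoreQuantile hp₀ ((hpos i).trans hn) (pos_of_mem_chamber hv i) hn
  have hgap : ∀ᶠ n : ℕ in atTop, gap F (1 / n) ≠ 0 := by
    filter_upwards [eventually_gt_atTop 1] with n hn
    have hn' : (1 : ℝ) < n := by exact_mod_cast hn
    exact (gap_pos hF hξ (one_div_pos.2 (one_pos.trans hn'))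
      ((div_lt_one (one_pos.trans hn')).2 hn')).ne'
  have hratio : ∀ i, Tendsto (fun n : ℕ => -(gap F (v i / p₀ / n) / gap F (1 / n))) atTop
      (𝓝 (-eta ξ (v i / p₀))) := fun i => (tendsto_gap_div_nat hF hξ (hpos i)).neg
  have hlt : -eta ξ (v j₀ / p₀) - -eta ξ (v jm / p₀) ≠ 0 := by
    have : eta ξ (v j₀ / p₀) < eta ξ (v jm / p₀) :=
      Real.rpow_lt_rpow (hpos _).le (div_lt_div_of_pos_right (hv.1 hj) hp₀)
        (neg_pos.2 hξ.index_neg)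
    linarith
  have hinv := ((hratio j₀).sub (hratio jm)).inv₀ hlt
  refine tendsto_pi_nhds.2 fun l => Tendsto.prodMk_nhds ?_ ?_
  · refine (hinv.mul (hratio (j l))).congr' ?_
    filter_upwards [hlog j₀, hlog jm, hlog (j l), hgap] with n h0 hm hl hg
    simp only [Function.comp, Pi.smul_apply, smul_eq_mul, h0, hm, hl]
    field_simp
    ring_nf
  · refine (hinv.mul (tendsto_gap_div_nat hF hξ (hk l)).neg).congr' ?_
    filter_upwards [hlog j₀, hlog jm, hgap] with n h0 hm hg
    simp only [Function.comp, Pi.smul_apply, smul_eq_mul, h0, hm]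
    have : quantile F (level (k l) n) - endpoint F = -gap F (k l / n) := by
      unfold level gap
      ring
    rw [this]
    field_simp
    ring_nf

/-- Joint convergence of the normalized extreme quantile estimators and of the normalized
population quantiles. -/
theorem tendstoInDistribution_estimators
    {Ω Ω' : Type*} [MeasurableSpace Ω] [MeasurableSpace Ω']
    {P : Measure Ω} [IsProbabilityMeasure P] {P' : Measure Ω'} [IsProbabilityMeasure P']
    {p : ℕ} {x : Fin p → ℝ} {X : ℕ → Ω → Fin p → ℝ} {Y : ℕ → Ω → ℝ}
    (hX : ∀ i, Measurable (X i)) (hY : ∀ i, Measurable (Y i))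
    (hindep : iIndepFun (fun i ω => (X i ω, Y i ω)) P)
    (hident : ∀ i, IdentDistrib (fun ω => (X i ω, Y i ω)) (fun ω => (X 0 ω, Y 0 ω)) P P)
    {p₀ : ℝ} (hp₀ : p₀ = P.real {ω | X 0 ω ≤ x}) (hp₀_pos : 0 < p₀)
    {F : ℝ → ℝ} (hF : F = condDistFun P (X 0) (Y 0) x)
    {ξ : ℝ} (hξ : InTypeThreeDomain F ξ)
    {qhat : ℕ → ℝ → Ω → ℝ} (hqhat : IsQuantileEstimator P X Y x qhat)
    {k₀ m : ℝ} (hk₀ : Admissible p₀ k₀) (hmk₀ : Admissible p₀ (m * k₀))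
    (hsep : k₀ * p₀ + 1 < m * k₀ * p₀)
    {L : ℕ} {k : Fin L → ℝ} (hk : ∀ l, Admissible p₀ (k l))
    {E : ℕ → Ω' → ℝ} (hE_indep : iIndepFun E P') (hE_law : ∀ i, HasLaw (E i) (expMeasure 1) P') :
    TendstoInDistribution
      (fun (n : ℕ) ω => fun l : Fin L =>
        (feasibleRate qhat k₀ m n ω * (qhat n (level (k l) n) ω - quantile F 1),
          feasibleRate qhat k₀ m n ω * (quantile F (level (k l) n) - quantile F 1)))
      atTop
      (fun ω' => fun l : Fin L =>
        ((limitZ E p₀ ξ k₀ ω' - limitZ E p₀ ξ (m * k₀) ω')⁻¹ * limitZ E p₀ ξ (k l) ω',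
          (limitZ E p₀ ξ k₀ ω' - limitZ E p₀ ξ (m * k₀) ω')⁻¹ * -eta ξ (k l)))
      (fun _ => P) P' := by
  have hdist : IsDistFun F := by
    rw [hF]
    exact isDistFun_condDistFun (hY 0) (hp₀ ▸ hp₀_pos)
  rw [quantile_one hdist hξ]
  set d := hIndex p₀ k₀ + hIndex p₀ (m * k₀) + ∑ l, hIndex p₀ (k l) with hd
  have h0d : hIndex p₀ k₀ ≤ d := by omega
  have hmd : hIndex p₀ (m * k₀) ≤ d := by omega
  have hkd : ∀ l, hIndex p₀ (k l) ≤ d := fun l =>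
    (Finset.single_le_sum (f := fun l => hIndex p₀ (k l)) (fun _ _ => Nat.zero_le _)
      (Finset.mem_univ l)).trans (Nat.le_add_left _ _)
  -- Coordinate `i` of `upperStats` is the `(i + 1)`-th largest value, hence the shift by one.
  let idx : ∀ κ, hIndex p₀ κ ≤ d → Fin (d + 1) := fun κ h => ⟨hIndex p₀ κ - 1, by omega⟩
  set j₀ := idx k₀ h0d with hj₀
  set jm := idx (m * k₀) hmd with hjm
  set j : Fin L → Fin (d + 1) := fun l => idx (k l) (hkd l) with hj
  have hstat : ∀ κ (h : hIndex p₀ κ ≤ d), 0 < κ → ∀ {n : ℕ} (y : Fin n → ℝ),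
      upperStats d y (idx κ h) = upperStat (hIndex p₀ κ) y := fun κ h hκ n y => by
    have := hIndex_pos hp₀_pos hκ
    simp only [upperStats, idx]
    congr 1
    omega
  have hsum : ∀ κ (h : hIndex p₀ κ ≤ d), 0 < κ → ∀ ω, limitZ E p₀ ξ κ ω
      = -eta ξ ((∑ i ∈ Finset.range (idx κ h + 1), E i ω) / p₀) := fun κ h hκ ω => by
    have := hIndex_pos hp₀_pos hκ
    simp only [limitZ, idx]
    rw [Finset.sum_div, Nat.sub_add_cancel this]
  -- The separation hypothesis gives `h(k₀) < k₀ p₀ + 1 < m k₀ p₀ ≤ h(m k₀)`.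
  have hjlt : j₀ < jm := by
    have h1 : hIndex p₀ k₀ < hIndex p₀ (m * k₀) := by
      have h2 := Nat.ceil_lt_add_one (mul_pos hk₀.1 hp₀_pos).le
      have h3 := Nat.le_ceil (m * k₀ * p₀)
      have h4 : (hIndex p₀ k₀ : ℝ) < hIndex p₀ (m * k₀) := by
        unfold hIndex
        linarith
      exact_mod_cast h4
    have h5 := hIndex_pos hp₀_pos hk₀.1
    change hIndex p₀ k₀ - 1 < hIndex p₀ (m * k₀) - 1
    omega
  have hEm : ∀ i, AEMeasurable (E i) P' := fun i => (hE_law i).aemeasurable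
  have hvm : AEMeasurable (fun ω (i : Fin (d + 1)) => ∑ a ∈ Finset.range (i + 1), E a ω) P' :=
    aemeasurable_pi_lambda _ fun i => Finset.aemeasurable_fun_sum _ fun a _ => hEm a
  have hlimit : (fun ω' => fun l : Fin L =>
        ((limitZ E p₀ ξ k₀ ω' - limitZ E p₀ ξ (m * k₀) ω')⁻¹ * limitZ E p₀ ξ (k l) ω',
          (limitZ E p₀ ξ k₀ ω' - limitZ E p₀ ξ (m * k₀) ω')⁻¹ * -eta ξ (k l)))
      = fun ω' => normalizedLimit p₀ ξ j₀ jm j k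
          fun i => ∑ a ∈ Finset.range (i + 1), E a ω' := by
    funext ω' l
    rw [hsum k₀ h0d hk₀.1, hsum (m * k₀) hmd hmk₀.1, hsum (k l) (hkd l) (hk l).1]
    rfl
  rw [hlimit]
  have hrate : ∀ n, AEMeasurable (feasibleRate qhat k₀ m n) P := fun n =>
    ((hqhat.aemeasurable n _).sub (hqhat.aemeasurable n _)).inv
  have hVm : ∀ n : ℕ, AEMeasurable (fun ω => fun l : Fin L =>
        (feasibleRate qhat k₀ m n ω * (qhat n (level (k l) n) ω - endpoint F),
          feasibleRate qhat k₀ m n ω * (quantile F (level (k l) n) - endpoint F))) P := fun n =>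
    aemeasurable_pi_lambda _ fun l =>
      ((hrate n).mul ((hqhat.aemeasurable n _).sub_const _)).prodMk ((hrate n).mul_const _)
  have hWm : AEMeasurable (fun ω' => normalizedLimit p₀ ξ j₀ jm j k
      fun i => ∑ a ∈ Finset.range (i + 1), E a ω') P' :=
    (measurable_normalizedLimit p₀ ξ j₀ jm j k).comp_aemeasurable hvm
  refine ⟨hVm, hWm, ?_⟩
  refine ProbabilityMeasure.tendsto_iff_forall_integral_tendsto.2 fun f => ?_
  simp only [ProbabilityMeasure.coe_mk]
  have hfm : Measurable f := f.continuous.measurable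
  rw [integral_map hWm hfm.aestronglyMeasurable,
    integral_partialSums hE_indep hE_law (Ψ := fun v => f (normalizedLimit p₀ ξ j₀ jm j k v))
      (hfm.comp (measurable_normalizedLimit p₀ ξ j₀ jm j k))]
  set sc : ∀ n : ℕ, Ω → Fin n → ℝ := fun n ω i => score x (X i ω, Y i ω) with hsc
  have hscm : ∀ n, Measurable (sc n) := fun n => measurable_pi_lambda _ fun i =>
    (measurable_score x).comp ((hX i).prodMk (hY i))
  have hg := measurable_scoreQuantile hdist hp₀_pos
  have hRm : ∀ n, Measurable fun y => f (normalized F j₀ jm j k n y) := fun n =>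
    hfm.comp (measurable_normalized F j₀ jm j k n)
  have hmain := tendsto_integral_upperStats (d := d) hg (antitoneOn_scoreQuantile hdist hp₀_pos)
    (Φ := fun n y => f (normalized F j₀ jm j k n y)) hRm (B := ‖f‖)
    (fun n u => f.norm_coe_le_norm _)
    (Ψ := fun v => f (normalizedLimit p₀ ξ j₀ jm j k v))
    fun v hv => (f.continuous.tendsto _).comp
      (tendsto_normalized hdist hξ hp₀_pos hjlt j (fun l => (hk l).1) hv)
  have hlaw : ∀ n : ℕ, ∫ S, f (normalized F j₀ jm j k n
      (upperStats d (scoreQuantile F p₀ ∘ S))) ∂(Measure.pi fun _ : Fin n => unif)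
        = ∫ ω, f (normalized F j₀ jm j k n (upperStats d (sc n ω))) ∂P := by
    intro n
    have hRu : Measurable fun y : Fin n → ℝ => f (normalized F j₀ jm j k n (upperStats d y)) :=
      (hRm n).comp (measurable_upperStats n d)
    have hgc : Measurable fun S : Fin n → ℝ => scoreQuantile F p₀ ∘ S :=
      measurable_pi_lambda _ fun i => hg.comp (measurable_pi_apply i)
    rw [← integral_map (hscm n).aemeasurable hRu.aestronglyMeasurable,
      map_scores hX hY hindep hident (hp₀ ▸ hp₀_pos) n, ← hF, ← hp₀,
      integral_map hgc.aemeasurable hRu.aestronglyMeasurable]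
  simp only [hlaw] at hmain
  -- Estimators and order statistics eventually coincide almost surely, so this bounded integrand is
  -- eventually zero.
  have hdiff : Tendsto (fun n : ℕ => ∫ ω, (f (fun l : Fin L =>
        (feasibleRate qhat k₀ m n ω * (qhat n (level (k l) n) ω - endpoint F),
          feasibleRate qhat k₀ m n ω * (quantile F (level (k l) n) - endpoint F)))
        - f (normalized F j₀ jm j k n (upperStats d (sc n ω)))) ∂P) atTop (𝓝 (∫ _, (0 : ℝ) ∂P)) := by
    refine tendsto_integral_of_dominated_convergence (fun _ => ‖f‖ + ‖f‖) ?_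
      (integrable_const _) ?_ ?_
    · exact fun n => ((hfm.comp_aemeasurable (hVm n)).sub ((hRm n).comp_aemeasurable
        ((measurable_upperStats n d).comp (hscm n)).aemeasurable)).aestronglyMeasurable
    · exact fun n => Eventually.of_forall fun ω => (norm_sub_le _ _).trans
        (add_le_add (f.norm_coe_le_norm _) (f.norm_coe_le_norm _))
    · have hae := fun κ (hκ : Admissible p₀ κ) =>
        ae_eventually_exp_eq_upperStat hX hindep hident hp₀ hp₀_pos hqhat hκ
      filter_upwards [hae k₀ hk₀, hae (m * k₀) hmk₀, ae_all_iff.2 fun l => hae (k l) (hk l)]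
        with ω h0 hm hl
      refine tendsto_const_nhds.congr' ?_
      filter_upwards [h0, hm, eventually_all.2 hl] with n h0 hm hl
      symm
      rw [sub_eq_zero]
      congr 1
      funext l
      simp only [normalized, feasibleRate]
      rw [hj₀, hjm, hj, hstat k₀ h0d hk₀.1, hstat (m * k₀) hmd hmk₀.1,
        hstat (k l) (hkd l) (hk l).1,
        ← h0, ← hm, ← hl l, Real.log_exp, Real.log_exp, Real.log_exp]
  have htot := hdiff.add hmain
  rw [integral_zero, zero_add] at htot
  refine htot.congr fun n => ?_
  rw [integral_map (hVm n) hfm.aestronglyMeasurable, integral_sub]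
  · ring
  · exact Integrable.of_bound (hfm.comp_aemeasurable (hVm n)).aestronglyMeasurable ‖f‖
      (Eventually.of_forall fun _ => f.norm_coe_le_norm _)
  · exact Integrable.of_bound ((hRm n).comp_aemeasurable
      ((measurable_upperStats n d).comp (hscm n)).aemeasurable).aestronglyMeasurable ‖f‖
      (Eventually.of_forall fun _ => f.norm_coe_le_norm _)

/-! ### Random weights and conclusion -/

/-- Along a common subsequence both limits hold almost surely, so one sample point suffices. -/
theorem add_eq_of_tendstoInMeasure {Ω : Type*} [MeasurableSpace Ω] {P : Measure Ω}
    [IsProbabilityMeasure P] {f g : ℕ → Ω → ℝ} {a b c : ℝ}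
    (hsum : ∀ n, ∀ᵐ ω ∂P, f n ω + g n ω = c)
    (hf : TendstoInMeasure P f atTop fun _ => a) (hg : TendstoInMeasure P g atTop fun _ => b) :
    a + b = c := by
  obtain ⟨ns, h1, h1'⟩ := hf.exists_seq_tendsto_ae'
  obtain ⟨ms, h2, h2'⟩ := (hg.comp h1).exists_seq_tendsto_ae'
  obtain ⟨ω, hω, hω1, hω2⟩ := ((ae_all_iff.2 hsum).and (h1'.and h2')).exists
  have h := (hω1.comp h2).add hω2
  refine tendsto_nhds_unique h (tendsto_const_nhds.congr fun n => ?_)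
  exact (hω _).symm

end ExtremeQuantile

open ExtremeQuantile in
theorem mainTheorem2
    {Ω Ω' : Type*} [MeasurableSpace Ω] [MeasurableSpace Ω']
    (P : Measure Ω) [IsProbabilityMeasure P] (P' : Measure Ω') [IsProbabilityMeasure P']
    {p : ℕ} (x : Fin p → ℝ)
    -- the i.i.d. sample of inputs and outputs, with `p₀ = P(X ≤ x) > 0`
    (X : ℕ → Ω → Fin p → ℝ) (Y : ℕ → Ω → ℝ)
    (hX : ∀ i, Measurable (X i)) (hY : ∀ i, Measurable (Y i))
    (hindep : iIndepFun (fun i ω => (X i ω, Y i ω)) P)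
    (hident : ∀ i, IdentDistrib (fun ω => (X i ω, Y i ω)) (fun ω => (X 0 ω, Y 0 ω)) P P)
    (p₀ : ℝ) (hp₀ : p₀ = P.real {ω | X 0 ω ≤ x}) (hp₀_pos : 0 < p₀)
    -- `F(· / x)` and its extreme value index
    (F : ℝ → ℝ) (hF : F = condDistFun P (X 0) (Y 0) x)
    (ξ : ℝ) (hξ : InTypeThreeDomain F ξ)
    -- the quantile estimators
    (qhat : ℕ → ℝ → Ω → ℝ) (hqhat : IsQuantileEstimator P X Y x qhat)
    -- the tuning constants
    (k₀ m : ℝ) (hm : 1 < m) (hk₀ : Admissible p₀ k₀) (hmk₀ : Admissible p₀ (m * k₀))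
    (hsep : k₀ * p₀ + 1 < m * k₀ * p₀)
    (L : ℕ) (k : Fin L → ℝ) (hk : ∀ l, Admissible p₀ (k l))
    -- the random weights
    (what₁ what₂ : ℕ → Ω → ℝ) (w₁ w₂ : ℝ)
    (hw₁_meas : ∀ n, AEMeasurable (what₁ n) P) (hw₂_meas : ∀ n, AEMeasurable (what₂ n) P)
    (hw_sum : ∀ n, ∀ᵐ ω ∂P, what₁ n ω + what₂ n ω = 1)
    (hw₁ : TendstoInMeasure P what₁ atTop (fun _ => w₁))
    (hw₂ : TendstoInMeasure P what₂ atTop (fun _ => w₂))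
    -- the i.i.d. standard exponential sequence of the limit
    (E : ℕ → Ω' → ℝ) (hE_indep : iIndepFun E P') (hE_law : ∀ i, HasLaw (E i) (expMeasure 1) P') :
    TendstoInDistribution
      (fun (n : ℕ) ω => fun l : Fin L =>
        feasibleRate qhat k₀ m n ω * (qhat n (level (k l) n) ω - quantile F 1))
      atTop
      (fun ω' => fun l : Fin L =>
        limitZ E p₀ ξ (k l) ω' / (limitZ E p₀ ξ k₀ ω' - limitZ E p₀ ξ (m * k₀) ω'))
      (fun _ => P) P'
    ∧ ∀ i j : Fin L,
      TendstoInDistribution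
        (fun (n : ℕ) ω => feasibleRate qhat k₀ m n ω *
          (what₁ n ω * qhat n (level (k i) n) ω + what₂ n ω * qhat n (level (k j) n) ω
            - (w₁ * quantile F (level (k i) n) + w₂ * quantile F (level (k j) n))))
        atTop
        (fun ω' => (w₁ * limitZc E p₀ ξ (k i) ω' + w₂ * limitZc E p₀ ξ (k j) ω')
          / (limitZ E p₀ ξ k₀ ω' - limitZ E p₀ ξ (m * k₀) ω'))
        (fun _ => P) P'
      ∧ TendstoInDistribution
        (fun (n : ℕ) ω => feasibleRate qhat k₀ m n ω *
          (what₁ n ω * qhat n (level (k i) n) ω + what₂ n ω * qhat n (level (k j) n) ω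
            - quantile F 1))
        atTop
        (fun ω' => (w₁ * limitZc E p₀ ξ (k i) ω' + w₂ * limitZc E p₀ ξ (k j) ω'
            - w₁ * eta ξ (k i) - w₂ * eta ξ (k j))
          / (limitZ E p₀ ξ k₀ ω' - limitZ E p₀ ξ (m * k₀) ω'))
        (fun _ => P) P' := by
  have hbase := tendstoInDistribution_estimators hX hY hindep hident hp₀ hp₀_pos hF hξ hqhat
    hk₀ hmk₀ hsep hk hE_indep hE_law
  have hw : w₁ + w₂ = 1 := add_eq_of_tendstoInMeasure hw_sum hw₁ hw₂
  refine ⟨?_, fun i j => ?_⟩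
  · have h := hbase.continuous_comp (g := fun u : Fin L → ℝ × ℝ => fun l => (u l).1)
      (by fun_prop)
    refine h.congr (fun n => Eventually.of_forall fun ω => rfl)
      (Eventually.of_forall fun ω' => funext fun l => ?_)
    exact inv_mul_eq_div _ _
  -- Slutsky: the weights have constant limits, so they join the convergence in distribution.
  · have hpair := (hbase.prodMk_of_tendstoInMeasure_const _ _ _ hw₁
      hw₁_meas).prodMk_of_tendstoInMeasure_const _ _ _ hw₂ hw₂_meas
    constructor
    -- Random and limiting weights both sum to `1`, so `q(1)` can be subtracted from every quantile.
    -- The second coordinates have limit numerator `-η(k)`, which produces the centering in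
    -- `limitZc`.
    · have h := hpair.continuous_comp (g := fun u : ((Fin L → ℝ × ℝ) × ℝ) × ℝ =>
        u.1.2 * (u.1.1 i).1 + u.2 * (u.1.1 j).1 - (w₁ * (u.1.1 i).2 + w₂ * (u.1.1 j).2))
        (by fun_prop)
      refine h.congr (fun n => ?_) (Eventually.of_forall fun ω' => ?_)
      · filter_upwards [hw_sum n] with ω hω
        simp only [Function.comp]
        linear_combination (-(feasibleRate qhat k₀ m n ω * quantile F 1)) * hω
          + feasibleRate qhat k₀ m n ω * quantile F 1 * hw
      · simp only [Function.comp, limitZc]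
        ring
    · have h := hpair.continuous_comp (g := fun u : ((Fin L → ℝ × ℝ) × ℝ) × ℝ =>
        u.1.2 * (u.1.1 i).1 + u.2 * (u.1.1 j).1) (by fun_prop)
      refine h.congr (fun n => ?_) (Eventually.of_forall fun ω' => ?_)
      · filter_upwards [hw_sum n] with ω hω
        simp only [Function.comp]
        linear_combination (-(feasibleRate qhat k₀ m n ω * quantile F 1)) * hω
      · simp only [Function.comp, limitZc]
        ring
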